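/- **Setting.** Let $d>0$, $r\in\mathbb N\cup\{\infty\}$. *Chebyshev scales.* A finite or infinite sequence $\mathcal I=(u_0,u_1,\dots)$ of functions in $C[0,d)\cap C^r(0,d)$ (with last index, if any, at most $r$; $r=\infty$ if it is infinite) is a Chebyshev scale if the operators $D_0(h)=h/u_0$, $D_{i+1}(h)=(D_i(h))'/(D_i(u_{i+1}))'$ are well defined on $(0,d)$ (that is, $u_0$ and all $(D_i(u_{i+1}))'$ have no zeros on $(0,d)$), every $D_i(u_{i+1})$, extended by continuity to $0$, is strictly increasing on $[0,d)$, and $\lim_{x\to0+}D_j(u_i)(x)=0$ for $j<i$. Values $D_i(h)(0)$ are limits as $x\to0+$. *Uniform development.* Let $\Lambda$ be a topological space, $\ell\in\mathbb N$, $\mathcal I_\lambda=(u_0(\cdot,\lambda),u_1(\cdot,\lambda),\dots)$, $\lambda\in\Lambda$, Chebyshev scales with a common index set containing $0,\dots,\ell$, and let $\mathcal F=\{f_\lambda\}_{\lambda\in\Lambda}$ be functions on $[0,d)$ with a uniform development of order $\ell$: $f_\lambda=\sum_{i=0}^{\ell}\alpha_i(\lambda)u_i(\cdot,\lambda)+\psi(\cdot,\lambda)$,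 where for $i\le\ell$ the $D_i(\psi(\cdot,\lambda))$ (taken in $\mathcal I_\lambda$) are defined on $(0,d)$ and have limit $0$ at $0$; the $D_jf_\lambda$, $j\le\ell$, extend by continuity to $x=0$ (with value $\alpha_j(\lambda)$) uniformly in $\lambda$, and for each $x\in[0,d)$ the value at $x$ of the extended function is continuous in $\lambda$. *The function.* Fix $\lambda_0\in\Lambda$, put $f=f_{\lambda_0}$, $\mathcal I=\mathcal I_{\lambda_0}=(u_0,u_1,\dots)$, and suppose that the $u_i$, $i\ge1$, are positive and strictly increasing on $(0,d)$. Suppose that $f\in C[0,d)\cap C^r(0,d)$, $f>0$ on $(0,d)$, $f(0)=f'(0)=0$, and that there are $m>1$ and $M>0$ with $m\le x(\log f)'(x)\le M$ on $(0,d)$ ($f$ is sublinear and satisfies the upper power condition). Let $g_\lambda=\mathrm{id}-f_\lambda$, $\mathcal G=\{g_\lambda\}$, $g=g_{\lambda_0}$. Let $x_0$ be in the basin of attraction of $0$: the orbit $S=S^g(x_0)=\{x_n\}$, $x_{n+1}=g(x_n)$, stays in $(0,d)$ and tends to $0$. Let $|A_\varepsilon(S)|$ be the Lebesgue measure of the $\varepsilon$-neighborhood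 of $S$. Write $F\simeq G$ if $A\le F/G\le B$ near $0+$ for some constants $A,B>0$. *Critical Minkowski order.* $m(g,\mathcal I)=k$ means that both $\max\{1\le i\le\ell:\liminf_{\varepsilon\to0}|A_\varepsilon(S)|/u_i^{-1}(\varepsilon)>0\}$ and the same maximum with $\limsup$ exist and equal $k$. *Multiplicity.* $\mu_0^{\rm fix}(g,\mathcal G)\in\mathbb N\cup\{\infty\}$ is the largest $m$ for which there are $\lambda_n\to\lambda_0$ and, for each $n$, $m$ distinct zeros $y^n_1,\dots,y^n_m\in(0,d)$ of $f_{\lambda_n}$, with $y^n_j\to0$ as $n\to\infty$ for each $j$. **Theorem.** Let $1\le k\le\ell$. Consider (i) $D_i(f)(0)=0$ for $i=0,\dots,k-1$ and $D_k(f)(0)>0$; (ii) $|A_\varepsilon(S^g(x_0))|\simeq u_k^{-1}(\varepsilon)$ as $\varepsilon\to0$; (iii) $m(g,\mathcal I)=k$. Then (i) is equivalent to $f\simeq u_k$ and to (ii), and (i) implies (iii). Conversely (iii) implies (i), provided that, in case $k=\ell$, not all of $D_0(f)(0),\dots,D_\ell(f)(0)$ vanish. Moreover (i) implies $\mu_0^{\rm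 fix}(g,\mathcal G)\le k$. Suppose in addition that $\Lambda\subset\mathbb R^N$ is a neighborhood of $\lambda_0$. If $k\le N$, $\alpha_0,\dots,\alpha_{k-1}$ are $C^1$ near $\lambda_0$ and the matrix $(\partial\alpha_i/\partial\lambda_j(\lambda_0))_{i=0,\dots,k-1;\,j=1,\dots,k}$ has rank $k$, then (i) implies $\mu_0^{\rm fix}(g,\mathcal G)=k$. If $k+1\le N$, $\alpha_0,\dots,\alpha_k$ are $C^1$ near $\lambda_0$ and the matrix $(\partial\alpha_i/\partial\lambda_j(\lambda_0))_{i=0,\dots,k;\,j=1,\dots,k+1}$ has rank $k+1$, then (i) is equivalent to $\mu_0^{\rm fix}(g,\mathcal G)=k$. -/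

import Mathlib

open Set Filter Topology MeasureTheory

noncomputable section

/-- The generalized derivative `D_i f` in the scale `u = (u_0, u_1, ...)`, on the open interval where
the scale lives: `D_0 f = f / u_0` and `D_{i+1} f = (D_i f)' / (D_i u_{i+1})'`.  Its value at the
endpoint `0` is always understood as the limit from the right. -/
def genDeriv (u : ℕ → ℝ → ℝ) : ℕ → (ℝ → ℝ) → ℝ → ℝ
  | 0, f => fun x => f x / u 0 x
  | i + 1, f => fun x => deriv (genDeriv u i f) x / deriv (genDeriv u i (u (i + 1))) x

/-- `D_i f (0) = a`, in the limit sense. -/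
def HasGenDerivAtZero (u : ℕ → ℝ → ℝ) (i : ℕ) (f : ℝ → ℝ) (a : ℝ) : Prop :=
  Tendsto (genDeriv u i f) (𝓝[>] 0) (𝓝 a)

/-- `D_i f (0) = 0` for `i = 0, ..., k - 1`, and `D_k f (0) > 0`. -/
def FirstGenDerivPos (u : ℕ → ℝ → ℝ) (f : ℝ → ℝ) (k : ℕ) : Prop :=
  (∀ i < k, HasGenDerivAtZero u i f 0) ∧ ∃ a : ℝ, 0 < a ∧ HasGenDerivAtZero u k f a

/-- `u_0, ..., u_L` (all `u_i`, if `L = ⊤`) is a Chebyshev scale of class `C[0,d) ∩ C^r(0,d)`.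
Values `u i` with `i > L` are ignored. -/
structure IsChebyshevScale (r L : ℕ∞) (d : ℝ) (u : ℕ → ℝ → ℝ) : Prop where
  le_smoothness : L ≤ r
  continuousOn : ∀ i : ℕ, (i : ℕ∞) ≤ L → ContinuousOn (u i) (Ico 0 d)
  contDiffOn : ∀ i : ℕ, (i : ℕ∞) ≤ L → ContDiffOn ℝ (r : WithTop ℕ∞) (u i) (Ioo 0 d)
  /-- The divisions in the algorithm are possible on `(0,d)`. -/
  zero_ne : ∀ x ∈ Ioo 0 d, u 0 x ≠ 0
  deriv_ne : ∀ i : ℕ, ((i + 1 : ℕ) : ℕ∞) ≤ L →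
    ∀ x ∈ Ioo 0 d, deriv (genDeriv u i (u (i + 1))) x ≠ 0
  /-- Together with the next field, this is strict monotonicity on `[0,d)` of the continuous
  extension of `D_i u_{i+1}`. -/
  strictMonoOn : ∀ i : ℕ, ((i + 1 : ℕ) : ℕ∞) ≤ L →
    StrictMonoOn (genDeriv u i (u (i + 1))) (Ioo 0 d)
  tendsto_zero : ∀ i j : ℕ, (i : ℕ∞) ≤ L → j < i → HasGenDerivAtZero u j (u i) 0

/-- `f = ∑_{i ≤ ℓ} α_i u_i + ψ` on `[0,d)`, where the generalized derivatives `D_i ψ`, `i ≤ ℓ`, are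
defined on `(0,d)` and vanish at `0` in the limit sense. -/
structure HasDevelopment (d : ℝ) (u : ℕ → ℝ → ℝ) (ℓ : ℕ) (f : ℝ → ℝ) (α : ℕ → ℝ) : Prop where
  differentiableOn : ∀ i < ℓ, DifferentiableOn ℝ
    (genDeriv u i (fun x => f x - ∑ j ∈ Finset.range (ℓ + 1), α j * u j x)) (Ioo 0 d)
  remainder : ∀ i ≤ ℓ,
    HasGenDerivAtZero u i (fun x => f x - ∑ j ∈ Finset.range (ℓ + 1), α j * u j x) 0

/-- Uniform development of order `ℓ` of the family `f` in the family of scales `u`: the generalized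
derivatives `D_j f_p`, `j ≤ ℓ`, extend by continuity to `x = 0` (with the values `α_j(p)`) uniformly
with respect to the parameter `p`, and the extended functions on `[0,d)` depend continuously on
`p`. -/
structure HasUniformDevelopment {Λ : Type*} [TopologicalSpace Λ] (d : ℝ) (u : Λ → ℕ → ℝ → ℝ)
    (ℓ : ℕ) (f : Λ → ℝ → ℝ) (α : ℕ → Λ → ℝ) : Prop where
  development : ∀ p, HasDevelopment d (u p) ℓ (f p) (fun i => α i p)
  uniform : ∀ j ≤ ℓ, TendstoUniformly (fun x p => genDeriv (u p) j (f p) x) (α j) (𝓝[>] 0)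
  continuous_zero : ∀ j ≤ ℓ, Continuous (α j)
  continuous_pos : ∀ j ≤ ℓ, ∀ x ∈ Ioo 0 d, Continuous (fun p => genDeriv (u p) j (f p) x)

/-- `x · (log f)'(x) ≥ m` on `(0,d)` for some `m > 1`. -/
def IsSublinear (d : ℝ) (f : ℝ → ℝ) : Prop :=
  ∃ m : ℝ, 1 < m ∧ ∀ x ∈ Ioo 0 d, m ≤ x * deriv (fun y => Real.log (f y)) x

/-- `x · (log f)'(x) ≤ M` on `(0,d)` for some `M > 0`. -/
def UpperPowerCondition (d : ℝ) (f : ℝ → ℝ) : Prop :=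
  ∃ M : ℝ, 0 < M ∧ ∀ x ∈ Ioo 0 d, x * deriv (fun y => Real.log (f y)) x ≤ M

/-- `F(x) ≃ G(x)` as `x → 0+`. -/
def Comparable (F G : ℝ → ℝ) : Prop :=
  ∃ A B : ℝ, 0 < A ∧ 0 < B ∧ ∀ᶠ x in 𝓝[>] (0 : ℝ), A ≤ F x / G x ∧ F x / G x ≤ B

/-- The orbit `S^g(x₀)`. -/
def orbitSet (g : ℝ → ℝ) (x₀ : ℝ) : Set ℝ := range (fun n : ℕ => g^[n] x₀)

/-- `x₀` lies in the basin of attraction of `0` in `(0,d)`: its orbit stays in `(0,d)` and tends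
to `0`. -/
def InBasin (d : ℝ) (g : ℝ → ℝ) (x₀ : ℝ) : Prop :=
  (∀ n : ℕ, g^[n] x₀ ∈ Ioo 0 d) ∧ Tendsto (fun n : ℕ => g^[n] x₀) atTop (𝓝 0)

/-- The length `|A_ε(S)|` of the `ε`-neighborhood of `S`. -/
def nbhdLength (S : Set ℝ) (ε : ℝ) : ℝ := volume.real (Metric.thickening ε S)

/-- The inverse of a strictly increasing function on `(0,d)`. -/
def invOn (d : ℝ) (v : ℝ → ℝ) : ℝ → ℝ := Function.invFunOn v (Ioo 0 d)

/-- Lower generalized Minkowski content of `S` with respect to the gauge function `v`. -/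
def lowerContent (d : ℝ) (S : Set ℝ) (v : ℝ → ℝ) : ENNReal :=
  liminf (fun ε => volume (Metric.thickening ε S) / ENNReal.ofReal (invOn d v ε)) (𝓝[>] 0)

/-- Upper generalized Minkowski content of `S` with respect to the gauge function `v`. -/
def upperContent (d : ℝ) (S : Set ℝ) (v : ℝ → ℝ) : ENNReal :=
  limsup (fun ε => volume (Metric.thickening ε S) / ENNReal.ofReal (invOn d v ε)) (𝓝[>] 0)

/-- `m(g, I) = k`, computed from the orbit of `x₀`: the lower and the upper critical Minkowski order
with respect to `u_1, ..., u_ℓ` both exist and are equal to `k`. -/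
def HasCriticalMinkowskiOrder (d : ℝ) (u : ℕ → ℝ → ℝ) (ℓ : ℕ) (g : ℝ → ℝ) (x₀ : ℝ) (k : ℕ) : Prop :=
  IsGreatest {i : ℕ | 1 ≤ i ∧ i ≤ ℓ ∧ 0 < lowerContent d (orbitSet g x₀) (u i)} k ∧
  IsGreatest {i : ℕ | 1 ≤ i ∧ i ≤ ℓ ∧ 0 < upperContent d (orbitSet g x₀) (u i)} k

/-- `0` is a zero of multiplicity at least `m` of `f_{p₀}` in the family `f`. -/
def ZeroMultiplicityGE {Λ : Type*} [TopologicalSpace Λ] (d : ℝ) (f : Λ → ℝ → ℝ) (p₀ : Λ)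
    (m : ℕ) : Prop :=
  ∃ (p : ℕ → Λ) (y : ℕ → Fin m → ℝ), Tendsto p atTop (𝓝 p₀) ∧
    (∀ n, Function.Injective (y n) ∧
      ∀ j, y n j ∈ Ico 0 d ∧ y n j ≠ 0 ∧ f (p n) (y n j) = 0) ∧
    ∀ j, Tendsto (fun n => y n j) atTop (𝓝 0)

/-- `μ_0(f_{p₀}, F)`: the largest `m` such that `0` is a zero of multiplicity at least `m`
(`⊤` if there is no largest one). -/
def zeroMultiplicity {Λ : Type*} [TopologicalSpace Λ] (d : ℝ) (f : Λ → ℝ → ℝ) (p₀ : Λ) : ℕ∞ :=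
  ⨆ (m : ℕ) (_ : ZeroMultiplicityGE d f p₀ m), (m : ℕ∞)

/-- `μ_0^fix(g_{p₀}, G)`: the multiplicity of `0` as a zero of `id - g_{p₀}` in the family
`id - g_p`. -/
def fixMultiplicity {Λ : Type*} [TopologicalSpace Λ] (d : ℝ) (g : Λ → ℝ → ℝ) (p₀ : Λ) : ℕ∞ :=
  zeroMultiplicity d (fun p x => x - g p x) p₀

/-- `n ≤ N`, the functions `a_0, ..., a_{n-1}` on `ℝ^N` are continuously differentiable near `q`, and
the matrix `(∂a_i/∂λ_j)(q)`, `i = 0, ..., n-1`, `j = 1, ..., n`, has rank `n`. -/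
def MaximalRankAt {N : ℕ} (a : ℕ → (Fin N → ℝ) → ℝ) (q : Fin N → ℝ) (n : ℕ) : Prop :=
  (∀ i < n, ContDiffAt ℝ 1 (a i) q) ∧
  ∃ h : n ≤ N, (Matrix.of (fun i j : Fin n =>
    fderiv ℝ (a i) q (Pi.single (Fin.castLE h j) 1))).rank = n

end

/-!
The generalized derivatives of `f` at `0` are the coefficients `α_i` of its development, so
`FirstGenDerivPos` says that `α_k > 0` is the first one that does not vanish. Everything is read off
from the first index `j` with `α_j ≠ 0`.

*Growth.* Applying L'Hôpital's rule `j` times (`IsChebyshevScale.tendsto_div`) gives `f / u_j → α_j`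
and `u_i / u_j → 0` for `i > j`; hence `f ≃ u_k` exactly when `j = k` and `α_k > 0`.

*Length.* Let `S` be the orbit. For small `y`, its points below `y` have gaps smaller than `f y`,
because `f` is increasing, and contribute a length comparable with `y`. By sublinearity the `N`
points above `y` satisfy `N f(y) ≤ C y`: along the orbit the quantity `x ^ (1 - m)` increases by at
least a fixed amount at each step. So `|A_{f(y)}(S)|` is comparable with `y`
(`InBasin.exists_nbhdLength_bounds`). The power bounds on `f` turn comparisons of `f` with `u_i` into
comparisons of `f⁻¹` with `u_i⁻¹` and back, which gives the statements on lengths and contents: the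
content with respect to `u_i` is positive for `i ≤ j` and zero for `i > j`.

*Multiplicity.* If `D_j f_{p₀} (0) ≠ 0` then, by uniformity, `D_j f_p` has no zeros in a fixed
interval `(0,δ)` for `p` near `p₀`, and by Rolle's theorem `f_p` has at most `j` zeros there.
Conversely, let `α_0, ..., α_{K-1}` vanish at `p₀` and form a submersion. Then `α_{K-1}`, `α_{K-2}`,
..., `α_0` can be made nonzero one after the other, each one small enough to preserve the sign
changes already present and with the sign that creates a new one closer to `0`. This gives `K` zeros
(`HasUniformDevelopment.le_zeroMultiplicity`). With rank `k + 1`, multiplicity `k` therefore excludes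
that all of `α_0, ..., α_k` vanish.
-/

/-! ### Generalized derivatives in a Chebyshev scale -/

theorem eventually_mem_Ioo_nhdsGT_zero {d : ℝ} (hd : 0 < d) : ∀ᶠ x in 𝓝[>] (0 : ℝ), x ∈ Ioo 0 d :=
  Ioo_mem_nhdsGT hd

theorem StrictMonoOn.pos_of_tendsto_zero {d : ℝ} {v : ℝ → ℝ} (hmono : StrictMonoOn v (Ioo 0 d))
    (h0 : Tendsto v (𝓝[>] 0) (𝓝 0)) {x : ℝ} (hx : x ∈ Ioo 0 d) : 0 < v x := by
  have hx2 : x / 2 ∈ Ioo 0 d := ⟨by linarith [hx.1], by linarith [hx.1, hx.2]⟩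
  have h1 : 0 ≤ v (x / 2) := by
    refine le_of_tendsto h0 ?_
    filter_upwards [Ioo_mem_nhdsGT hx2.1] with t ht
    exact (hmono ⟨ht.1, ht.2.trans hx2.2⟩ hx2 ht.2).le
  exact h1.trans_lt (hmono hx2 hx (by linarith [hx.1]))

namespace IsChebyshevScale

variable {r L : ℕ∞} {d : ℝ} {u : ℕ → ℝ → ℝ}

theorem contDiffOn_genDeriv (hu : IsChebyshevScale r L d u) (i : ℕ) :
    ∀ (n : ℕ) (h : ℝ → ℝ), (i : ℕ∞) ≤ L → ((i + n : ℕ) : ℕ∞) ≤ r →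
      ContDiffOn ℝ (r : WithTop ℕ∞) h (Ioo 0 d) →
      ContDiffOn ℝ (n : WithTop ℕ∞) (genDeriv u i h) (Ioo 0 d) := by
  induction i with
  | zero =>
    intro n h _ hn hh
    have hn' : (n : WithTop ℕ∞) ≤ (r : WithTop ℕ∞) := by
      rw [zero_add] at hn
      exact_mod_cast hn
    exact (hh.of_le hn').div ((hu.contDiffOn 0 (by simp)).of_le hn') hu.zero_ne
  | succ i ih =>
    intro n h hi hn hh
    have hi' : (i : ℕ∞) ≤ L := le_trans (by exact_mod_cast Nat.le_succ i) hi
    have hn' : ((i + (n + 1) : ℕ) : ℕ∞) ≤ r := by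
      rwa [show i + (n + 1) = i + 1 + n by ring]
    have key : ∀ w : ℝ → ℝ, ContDiffOn ℝ (r : WithTop ℕ∞) w (Ioo 0 d) →
        ContDiffOn ℝ (n : WithTop ℕ∞) (deriv (genDeriv u i w)) (Ioo 0 d) := fun w hw =>
      (ih (n + 1) w hi' hn' hw).deriv_of_isOpen isOpen_Ioo (by push_cast; exact le_rfl)
    exact (key h hh).div (key _ (hu.contDiffOn _ hi)) (hu.deriv_ne i hi)

theorem differentiableOn_genDeriv (hu : IsChebyshevScale r L d u) {i j : ℕ}
    (hi : ((i + 1 : ℕ) : ℕ∞) ≤ L) (hj : (j : ℕ∞) ≤ L) :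
    DifferentiableOn ℝ (genDeriv u i (u j)) (Ioo 0 d) :=
  (hu.contDiffOn_genDeriv i 1 (u j) (le_trans (by exact_mod_cast Nat.le_succ i) hi)
    (hi.trans hu.le_smoothness) (hu.contDiffOn j hj)).differentiableOn (by simp)

theorem genDeriv_self (hu : IsChebyshevScale r L d u) {j : ℕ} (hj : (j : ℕ∞) ≤ L) {x : ℝ}
    (hx : x ∈ Ioo 0 d) : genDeriv u j (u j) x = 1 := by
  cases j with
  | zero => exact div_self (hu.zero_ne x hx)
  | succ i => exact div_self (hu.deriv_ne i hj x hx)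

theorem deriv_genDeriv (hu : IsChebyshevScale r L d u) {i : ℕ} (hi : ((i + 1 : ℕ) : ℕ∞) ≤ L)
    (h : ℝ → ℝ) {x : ℝ} (hx : x ∈ Ioo 0 d) :
    deriv (genDeriv u i h) x =
      genDeriv u (i + 1) h x * deriv (genDeriv u i (u (i + 1))) x :=
  (div_mul_cancel₀ _ (hu.deriv_ne i hi x hx)).symm

/-- The algorithm is run backwards from `D_j u_j = 1`: if `D_{i+1} u_j > 0` then `D_i u_j` increases
from its limit `0` at `0`. -/
theorem genDeriv_pos (hu : IsChebyshevScale r L d u) {i j : ℕ} (hij : i ≤ j)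
    (hj : (j : ℕ∞) ≤ L) : ∀ x ∈ Ioo 0 d, 0 < genDeriv u i (u j) x := by
  induction hij using Nat.decreasingInduction with
  | self => exact fun x hx => by simp [hu.genDeriv_self hj hx]
  | of_succ i hi ih =>
    have hiL : ((i + 1 : ℕ) : ℕ∞) ≤ L := le_trans (by exact_mod_cast hi) hj
    have hdiff := hu.differentiableOn_genDeriv hiL hj
    have hmono : StrictMonoOn (genDeriv u i (u j)) (Ioo 0 d) := by
      refine strictMonoOn_of_deriv_pos (convex_Ioo 0 d) hdiff.continuousOn fun x hx => ?_
      rw [interior_Ioo] at hx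
      rw [hu.deriv_genDeriv hiL _ hx]
      refine mul_pos (ih x hx) (lt_of_le_of_ne ?_ (hu.deriv_ne i hiL x hx).symm)
      rw [← derivWithin_of_isOpen isOpen_Ioo hx]
      exact (hu.strictMonoOn i hiL).monotoneOn.derivWithin_nonneg
    exact fun x hx => hmono.pos_of_tendsto_zero (hu.tendsto_zero j i hj hi) hx

/-- L'Hôpital's rule, applied `j` times: if `D_i h (0) = 0` for `i < j`, then `h / u_j` has the
limit `D_j h (0)` at `0`. -/
theorem tendsto_div (hu : IsChebyshevScale r L d u) (hd : 0 < d) {j : ℕ} (hj : (j : ℕ∞) ≤ L)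
    {h : ℝ → ℝ} {a : ℝ} (hh : ∀ i < j, DifferentiableOn ℝ (genDeriv u i h) (Ioo 0 d))
    (h0 : ∀ i < j, HasGenDerivAtZero u i h 0) (ha : HasGenDerivAtZero u j h a) :
    Tendsto (fun x => h x / u j x) (𝓝[>] 0) (𝓝 a) := by
  have hIoo := eventually_mem_Ioo_nhdsGT_zero hd
  have key : ∀ i ≤ j, Tendsto (fun x => genDeriv u i h x / genDeriv u i (u j) x) (𝓝[>] 0) (𝓝 a) := by
    intro i hij
    induction hij using Nat.decreasingInduction with
    | self =>
      refine ha.congr' ?_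
      filter_upwards [hIoo] with x hx
      rw [hu.genDeriv_self hj hx, div_one]
    | of_succ i hi ih =>
      have hiL : ((i + 1 : ℕ) : ℕ∞) ≤ L := le_trans (by exact_mod_cast hi) hj
      refine deriv.lhopital_zero_nhdsGT ?_ ?_ (h0 i hi) (hu.tendsto_zero j i hj hi) ?_
      · filter_upwards [hIoo] with x hx
        exact (hh i hi).differentiableAt (Ioo_mem_nhds hx.1 hx.2)
      · filter_upwards [hIoo] with x hx
        rw [hu.deriv_genDeriv hiL _ hx]
        exact mul_ne_zero (hu.genDeriv_pos hi hj x hx).ne' (hu.deriv_ne i hiL x hx)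
      · refine ih.congr' ?_
        filter_upwards [hIoo] with x hx
        rw [hu.deriv_genDeriv hiL h hx, hu.deriv_genDeriv hiL (u j) hx,
          mul_div_mul_right _ _ (hu.deriv_ne i hiL x hx)]
  refine (key 0 (Nat.zero_le j)).congr' ?_
  filter_upwards [hIoo] with x hx
  exact div_div_div_cancel_right₀ (hu.zero_ne x hx) _ _

theorem tendsto_div_of_lt (hu : IsChebyshevScale r L d u) (hd : 0 < d) {i j : ℕ} (hij : i < j)
    (hj : (j : ℕ∞) ≤ L) : Tendsto (fun x => u j x / u i x) (𝓝[>] 0) (𝓝 0) := by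
  refine hu.tendsto_div hd (le_trans (by exact_mod_cast hij.le) hj) (fun m hm => ?_)
    (fun m hm => hu.tendsto_zero j m hj (hm.trans hij)) (hu.tendsto_zero j i hj hij)
  exact hu.differentiableOn_genDeriv (le_trans (by exact_mod_cast (hm.trans hij)) hj) hj

theorem tendsto_nhds_zero (hu : IsChebyshevScale r L d u) (hd : 0 < d) {j : ℕ} (hj0 : 1 ≤ j)
    (hj : (j : ℕ∞) ≤ L) : Tendsto (u j) (𝓝[>] 0) (𝓝 0) := by
  have h0 : Tendsto (u 0) (𝓝[>] 0) (𝓝 (u 0 0)) :=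
    ((hu.continuousOn 0 (by simp)).continuousWithinAt (left_mem_Ico.2 hd)).tendsto.mono_left
      (nhdsWithin_le_of_mem (mem_of_superset (Ioo_mem_nhdsGT hd) Ioo_subset_Ico_self))
  have h1 := (hu.tendsto_div_of_lt hd hj0 hj).mul h0
  rw [zero_mul] at h1
  refine h1.congr' ?_
  filter_upwards [eventually_mem_Ioo_nhdsGT_zero hd] with x hx
  exact div_mul_cancel₀ _ (hu.zero_ne x hx)

/-- Linearity of `D_i` on `(0,d)`, as far as the generalized derivatives of the remainder exist. -/
theorem genDeriv_add_sum (hu : IsChebyshevScale r L d u) {ℓ : ℕ} (hℓ : (ℓ : ℕ∞) ≤ L)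
    {ψ : ℝ → ℝ} (hψ : ∀ i < ℓ, DifferentiableOn ℝ (genDeriv u i ψ) (Ioo 0 d)) (c : ℕ → ℝ) :
    ∀ i ≤ ℓ, EqOn (genDeriv u i (fun x => ψ x + ∑ j ∈ Finset.range (ℓ + 1), c j * u j x))
      (fun x => genDeriv u i ψ x + ∑ j ∈ Finset.range (ℓ + 1), c j * genDeriv u i (u j) x)
      (Ioo 0 d) := by
  intro i
  induction i with
  | zero =>
    intro _ x _
    simp only [genDeriv, add_div, Finset.sum_div, mul_div_assoc]
  | succ i ih =>
    intro hi x hx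
    have hnhds : Ioo 0 d ∈ 𝓝 x := Ioo_mem_nhds hx.1 hx.2
    have hjd : ∀ j ∈ Finset.range (ℓ + 1),
        DifferentiableAt ℝ (fun x => c j * genDeriv u i (u j) x) x := fun j hj =>
      ((hu.differentiableOn_genDeriv (le_trans (by exact_mod_cast hi) hℓ)
        (le_trans (by exact_mod_cast Finset.mem_range_succ_iff.1 hj) hℓ)).differentiableAt
          hnhds).const_mul (c j)
    change deriv _ x / _ = deriv _ x / _ + ∑ j ∈ _, c j * (deriv _ x / _)
    rw [((ih (by omega)).eventuallyEq_of_mem hnhds).deriv_eq,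
      deriv_fun_add ((hψ i (by omega)).differentiableAt hnhds)
        (DifferentiableAt.fun_sum hjd), deriv_fun_sum hjd, add_div, Finset.sum_div]
    congr 1
    refine Finset.sum_congr rfl fun j _ => ?_
    rw [deriv_const_mul_field, mul_div_assoc]

end IsChebyshevScale

theorem HasDevelopment.differentiableOn_genDeriv {r L : ℕ∞} {d : ℝ} {u : ℕ → ℝ → ℝ} {ℓ : ℕ}
    {f : ℝ → ℝ} {α : ℕ → ℝ} (hf : HasDevelopment d u ℓ f α) (hu : IsChebyshevScale r L d u)
    (hℓ : (ℓ : ℕ∞) ≤ L) {i : ℕ} (hi : i < ℓ) :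
    DifferentiableOn ℝ (genDeriv u i f) (Ioo 0 d) := by
  have h := hu.genDeriv_add_sum hℓ hf.differentiableOn α i hi.le
  simp only [sub_add_cancel] at h
  refine DifferentiableOn.congr ?_ h
  refine (hf.differentiableOn i hi).add (DifferentiableOn.fun_sum fun j hj => ?_)
  exact (hu.differentiableOn_genDeriv (le_trans (by exact_mod_cast hi) hℓ)
    (le_trans (by exact_mod_cast Finset.mem_range_succ_iff.1 hj) hℓ)).const_mul (α j)

/-! ### Power bounds -/

section PowerBounds

variable {d : ℝ} {f : ℝ → ℝ}

/-- If `x (log f)' ≥ c > 0` then `log f - c log` increases, so `f` grows at least like `x ^ c`. -/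
theorem mul_rpow_le_of_le_mul_deriv_log (hfpos : ∀ x ∈ Ioo 0 d, 0 < f x) {c : ℝ}
    (hdiff : DifferentiableOn ℝ (fun y => Real.log (f y)) (Ioo 0 d))
    (hc : ∀ x ∈ Ioo 0 d, c ≤ x * deriv (fun y => Real.log (f y)) x)
    {a b : ℝ} (ha : a ∈ Ioo 0 d) (hb : b ∈ Ioo 0 d) (hab : a ≤ b) :
    f a * (b / a) ^ c ≤ f b := by
  have hlog : ∀ x ∈ Ioo 0 d, HasDerivAt (fun y => Real.log (f y) - c * Real.log y)
      (deriv (fun y => Real.log (f y)) x - c * x⁻¹) x := fun x hx =>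
    ((hdiff.differentiableAt (Ioo_mem_nhds hx.1 hx.2)).hasDerivAt).sub
      ((Real.hasDerivAt_log hx.1.ne').const_mul c)
  have hmono : MonotoneOn (fun y => Real.log (f y) - c * Real.log y) (Ioo 0 d) := by
    refine monotoneOn_of_deriv_nonneg (convex_Ioo 0 d)
      (fun x hx => (hlog x hx).continuousAt.continuousWithinAt) ?_ ?_
    · rw [interior_Ioo]
      exact fun x hx => (hlog x hx).differentiableAt.differentiableWithinAt
    · rw [interior_Ioo]
      intro x hx
      rw [(hlog x hx).deriv, sub_nonneg, ← div_eq_mul_inv, div_le_iff₀' hx.1]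
      exact hc x hx
  have h := hmono ha hb hab
  have hba : 0 < b / a := div_pos hb.1 ha.1
  rw [← Real.log_le_log_iff (mul_pos (hfpos a ha) (Real.rpow_pos_of_pos hba c)) (hfpos b hb),
    Real.log_mul (hfpos a ha).ne' (Real.rpow_pos_of_pos hba c).ne', Real.log_rpow hba,
    Real.log_div hb.1.ne' ha.1.ne']
  simp only at h
  linarith

theorem mul_rpow_le_of_mul_deriv_log_le (hfpos : ∀ x ∈ Ioo 0 d, 0 < f x) {c : ℝ}
    (hdiff : DifferentiableOn ℝ (fun y => Real.log (f y)) (Ioo 0 d))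
    (hc : ∀ x ∈ Ioo 0 d, x * deriv (fun y => Real.log (f y)) x ≤ c)
    {a b : ℝ} (ha : a ∈ Ioo 0 d) (hb : b ∈ Ioo 0 d) (hab : a ≤ b) :
    f b ≤ f a * (b / a) ^ c := by
  have h := mul_rpow_le_of_le_mul_deriv_log (f := fun x => (f x)⁻¹) (c := -c)
    (fun x hx => inv_pos.2 (hfpos x hx)) (by simpa only [Real.log_inv] using hdiff.fun_neg)
    (fun x hx => by
      simp only [Real.log_inv, deriv.fun_neg]
      linarith [hc x hx]) ha hb hab
  rw [Real.rpow_neg (div_pos hb.1 ha.1).le, ← mul_inv] at h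
  exact (inv_le_inv₀ (mul_pos (hfpos a ha) (Real.rpow_pos_of_pos (div_pos hb.1 ha.1) c))
    (hfpos b hb)).1 h

theorem IsSublinear.differentiableOn_log (hsub : IsSublinear d f) :
    DifferentiableOn ℝ (fun y => Real.log (f y)) (Ioo 0 d) := by
  obtain ⟨m, hm, h⟩ := hsub
  refine fun x hx => (differentiableAt_of_deriv_ne_zero fun h0 => ?_).differentiableWithinAt
  have := h x hx
  rw [h0] at this
  linarith

theorem IsSublinear.exists_mul_rpow_le (hsub : IsSublinear d f)
    (hfpos : ∀ x ∈ Ioo 0 d, 0 < f x) :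
    ∃ m : ℝ, 1 < m ∧ ∀ a ∈ Ioo 0 d, ∀ b ∈ Ioo 0 d, a ≤ b → f a * (b / a) ^ m ≤ f b := by
  have hdiff := hsub.differentiableOn_log
  obtain ⟨m, hm, h⟩ := hsub
  exact ⟨m, hm, fun a ha b hb hab => mul_rpow_le_of_le_mul_deriv_log hfpos hdiff h ha hb hab⟩

theorem IsSublinear.strictMonoOn (hsub : IsSublinear d f) (hfpos : ∀ x ∈ Ioo 0 d, 0 < f x) :
    StrictMonoOn f (Ioo 0 d) := by
  obtain ⟨m, hm, h⟩ := hsub.exists_mul_rpow_le hfpos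
  intro a ha b hb hab
  refine lt_of_lt_of_le ?_ (h a ha b hb hab.le)
  exact lt_mul_of_one_lt_right (hfpos a ha)
    (Real.one_lt_rpow ((one_lt_div ha.1).2 hab) (by linarith))

theorem IsSublinear.le_mul_of_le_mul (hsub : IsSublinear d f) (hfpos : ∀ x ∈ Ioo 0 d, 0 < f x)
    {C : ℝ} (hC : 1 ≤ C) {a b : ℝ} (ha : a ∈ Ioo 0 d) (hb : b ∈ Ioo 0 d) (h : f a ≤ C * f b) :
    a ≤ C * b := by
  obtain ⟨m, hm, hpow⟩ := hsub.exists_mul_rpow_le hfpos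
  rcases le_total a b with hab | hab
  · exact hab.trans (le_mul_of_one_le_left hb.1.le hC)
  · have h1 : 1 ≤ a / b := (one_le_div hb.1).2 hab
    have h2 : a / b ≤ (a / b) ^ m := by
      simpa using Real.rpow_le_rpow_of_exponent_le h1 hm.le
    have h3 : f b * (a / b) ≤ f b * C :=
      (mul_le_mul_of_nonneg_left h2 (hfpos b hb).le).trans
        ((hpow b hb a ha hab).trans (h.trans_eq (mul_comm _ _)))
    exact (div_le_iff₀ hb.1).1 (le_of_mul_le_mul_left h3 (hfpos b hb))

theorem UpperPowerCondition.exists_le_rpow_mul (hupper : UpperPowerCondition d f)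
    (hsub : IsSublinear d f) (hfpos : ∀ x ∈ Ioo 0 d, 0 < f x) :
    ∃ M : ℝ, 0 < M ∧ ∀ C : ℝ, 1 ≤ C → ∀ a ∈ Ioo 0 d, ∀ b ∈ Ioo 0 d, a ≤ C * b →
      f a ≤ C ^ M * f b := by
  obtain ⟨M, hM, h⟩ := hupper
  refine ⟨M, hM, fun C hC a ha b hb hab => ?_⟩
  rcases le_total a b with hab' | hab'
  · exact ((hsub.strictMonoOn hfpos).monotoneOn ha hb hab').trans
      (le_mul_of_one_le_left (hfpos b hb).le (Real.one_le_rpow hC hM.le))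
  · refine (mul_rpow_le_of_mul_deriv_log_le hfpos hsub.differentiableOn_log h hb ha hab').trans ?_
    rw [mul_comm]
    refine mul_le_mul_of_nonneg_right ?_ (hfpos b hb).le
    exact Real.rpow_le_rpow (div_pos ha.1 hb.1).le ((div_le_iff₀ hb.1).2 hab) hM.le

end PowerBounds

/-! ### The neighborhood of an orbit -/

/-- Bernoulli's inequality for a negative exponent. -/
theorem one_sub_mul_sub_one_le_rpow {s m : ℝ} (hs : 0 < s) (hm : 1 ≤ m) :
    1 - (m - 1) * (s - 1) ≤ s ^ (1 - m) := by
  rw [Real.rpow_def_of_pos hs]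
  have h1 := Real.add_one_le_exp (Real.log s * (1 - m))
  have h2 := Real.log_le_sub_one_of_pos hs
  nlinarith

section Orbit

variable {d : ℝ} {f : ℝ → ℝ} {x₀ : ℝ}

theorem orbit_succ (g : ℝ → ℝ) (x₀ : ℝ) (n : ℕ) : g^[n + 1] x₀ = g (g^[n] x₀) :=
  Function.iterate_succ_apply' g n x₀

theorem InBasin.strictAnti (hx₀ : InBasin d (fun x => x - f x) x₀)
    (hfpos : ∀ x ∈ Ioo 0 d, 0 < f x) : StrictAnti fun n => (fun x => x - f x)^[n] x₀ := by
  refine strictAnti_nat_of_succ_lt fun n => ?_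
  rw [orbit_succ]
  have := hfpos _ (hx₀.1 n)
  linarith

/-- The number `N` of orbit points above `y` is at most of order `y / f y`: at each of them the
increment of `x ^ (1 - m)` along the orbit is bounded below, by sublinearity, and the sum of the
increments is controlled by the last orbit point. -/
theorem InBasin.card_mul_le (hx₀ : InBasin d (fun x => x - f x) x₀) {m : ℝ} (hm : 1 < m)
    (hpow : ∀ a ∈ Ioo 0 d, ∀ b ∈ Ioo 0 d, a ≤ b → f a * (b / a) ^ m ≤ f b) {y : ℝ}
    (hy : y ∈ Ioo 0 d) {N : ℕ} (hN : ∀ n < N, y ≤ (fun x => x - f x)^[n] x₀)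
    (hNy : y / 2 ≤ (fun x => x - f x)^[N] x₀) :
    N * f y ≤ (2 ^ (m - 1) / (m - 1)) * y := by
  set x : ℕ → ℝ := fun n => (fun x => x - f x)^[n] x₀ with hx
  have hsucc : ∀ n, x (n + 1) = x n - f (x n) := fun n => orbit_succ _ x₀ n
  have hpos : ∀ n, 0 < x n := fun n => (hx₀.1 n).1
  have hm1 : 0 < m - 1 := by linarith
  have hstep : ∀ n < N, (m - 1) * (f y / y) ≤
      (x (n + 1) / y) ^ (1 - m) - (x n / y) ^ (1 - m) := by
    intro n hn
    have ht : 0 < x n / y := div_pos (hpos n) hy.1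
    have hs : 0 < x (n + 1) / x n := div_pos (hpos _) (hpos n)
    have e1 : x (n + 1) / y = x (n + 1) / x n * (x n / y) :=
      (div_mul_div_cancel₀ (hpos n).ne').symm
    have e2 : x (n + 1) / x n - 1 = -(f (x n) / x n) := by
      rw [hsucc]
      field_simp [(hpos n).ne']
      ring
    have e3 : (x n / y) ^ (1 - m) * (x n / y) ^ m = x n / y := by
      rw [← Real.rpow_add ht]
      simp
    have hb := one_sub_mul_sub_one_le_rpow hs hm.le
    rw [e2] at hb
    have hq := hpow y hy (x n) (hx₀.1 n) (hN n hn)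
    rw [e1, Real.mul_rpow hs.le ht.le]
    set w := (x n / y) ^ (1 - m) with hw
    have hw0 : 0 < w := Real.rpow_pos_of_pos ht _
    have h1 : w * (1 + (m - 1) * (f (x n) / x n)) ≤ (x (n + 1) / x n) ^ (1 - m) * w := by
      rw [mul_comm]
      exact mul_le_mul_of_nonneg_right (by linarith) hw0.le
    have h2 : f y / y ≤ w * (f (x n) / x n) := by
      have : w * (f y * (x n / y) ^ m) ≤ w * f (x n) := mul_le_mul_of_nonneg_left hq hw0.le
      rw [← mul_div_assoc, le_div_iff₀ (hpos n)]
      calc f y / y * x n = f y * (x n / y) := by ring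
        _ = w * (f y * (x n / y) ^ m) := by linear_combination (-(f y)) * e3
        _ ≤ _ := this
    nlinarith [mul_le_mul_of_nonneg_left h2 hm1.le]
  have hsum : N * ((m - 1) * (f y / y)) ≤ (x N / y) ^ (1 - m) - (x 0 / y) ^ (1 - m) := by
    rw [← Finset.sum_range_sub (fun n => (x n / y) ^ (1 - m)) N, ← nsmul_eq_mul]
    simpa using Finset.card_nsmul_le_sum (Finset.range N)
      (fun n => (x (n + 1) / y) ^ (1 - m) - (x n / y) ^ (1 - m)) ((m - 1) * (f y / y))
      (fun n hn => hstep n (Finset.mem_range.1 hn))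
  have h0 : 0 < (x 0 / y) ^ (1 - m) := Real.rpow_pos_of_pos (div_pos (hpos 0) hy.1) _
  have hlast : (x N / y) ^ (1 - m) ≤ 2 ^ (m - 1) := by
    have h2 : (1 / 2 : ℝ) ≤ x N / y := by
      rw [le_div_iff₀ hy.1]
      linarith
    refine (Real.rpow_le_rpow_of_nonpos (by norm_num) h2 (by linarith)).trans_eq ?_
    rw [one_div, Real.inv_rpow (by norm_num), ← Real.rpow_neg (by norm_num)]
    congr 1
    ring
  have hfin : N * ((m - 1) * (f y / y)) ≤ 2 ^ (m - 1) := by linarith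
  rw [div_mul_eq_mul_div, le_div_iff₀ hm1]
  calc N * f y * (m - 1) = N * ((m - 1) * (f y / y)) * y := by field_simp [hy.1.ne']
    _ ≤ _ := mul_le_mul_of_nonneg_right hfin hy.1.le

theorem thickening_orbitSet_subset (g : ℝ → ℝ) (x₀ : ℝ) {ε y : ℝ} {N : ℕ}
    (hN : ∀ n, N ≤ n → g^[n] x₀ ∈ Icc 0 y) :
    Metric.thickening ε (orbitSet g x₀) ⊆
      (⋃ n ∈ Finset.range N, Metric.ball (g^[n] x₀) ε) ∪ Ioo (-ε) (y + ε) := by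
  intro t ht
  obtain ⟨_, ⟨n, rfl⟩, hn⟩ := Metric.mem_thickening_iff.1 ht
  rcases lt_or_ge n N with h | h
  · exact Or.inl (mem_biUnion (Finset.mem_coe.2 (Finset.mem_range.2 h)) hn)
  · right
    obtain ⟨h1, h2⟩ := hN n h
    rw [Real.dist_eq, abs_lt] at hn
    exact ⟨by linarith, by linarith⟩

/-- The tail of the orbit below `y` is `f y`-dense in `(0, g^N x₀)`, since `f` is increasing. -/
theorem InBasin.Ioo_subset_thickening (hx₀ : InBasin d (fun x => x - f x) x₀)
    (hfpos : ∀ x ∈ Ioo 0 d, 0 < f x) (hmono : StrictMonoOn f (Ioo 0 d)) {y : ℝ}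
    (hy : y ∈ Ioo 0 d) {N : ℕ} (hNy : (fun x => x - f x)^[N] x₀ < y) :
    Ioo 0 ((fun x => x - f x)^[N] x₀) ⊆
      Metric.thickening (f y) (orbitSet (fun x => x - f x) x₀) := by
  have hanti := hx₀.strictAnti hfpos
  intro t ht
  have hex : ∃ n, (fun x => x - f x)^[n] x₀ ≤ t :=
    ((hx₀.2.eventually_lt_const ht.1).exists).imp fun n hn => hn.le
  classical
  obtain ⟨hle, hmin⟩ := And.intro (Nat.find_spec hex) (fun n => Nat.find_min (H := hex) (m := n))
  generalize Nat.find hex = n at hle hmin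
  have hNn : N < n := by
    by_contra! h
    exact absurd ht.2 (not_lt.2 ((hanti.antitone h).trans hle))
  obtain ⟨n, rfl⟩ : ∃ j, n = j + 1 := ⟨n - 1, by omega⟩
  have hgt := not_le.1 (hmin n (Nat.lt_succ_self n))
  rw [orbit_succ] at hle
  have hxy : (fun x => x - f x)^[n] x₀ < y :=
    lt_of_le_of_lt (hanti.antitone (Nat.lt_succ_iff.1 hNn)) hNy
  have hf := hmono (hx₀.1 n) hy hxy
  refine Metric.mem_thickening_iff.2 ⟨_, ⟨n, rfl⟩, ?_⟩
  rw [Real.dist_eq, abs_lt]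
  simp only at hle ⊢
  constructor <;> linarith [hfpos y hy]

/-- The length of the `f y`-neighborhood of the orbit is comparable with `y`. -/
theorem InBasin.exists_nbhdLength_bounds (hfpos : ∀ x ∈ Ioo 0 d, 0 < f x)
    (hf0 : f 0 = 0) (hf0' : HasDerivWithinAt f 0 (Ici 0) 0) (hsub : IsSublinear d f)
    (hx₀ : InBasin d (fun x => x - f x) x₀) :
    ∃ c C : ℝ, 0 < c ∧ 0 < C ∧ ∀ᶠ y in 𝓝[>] (0 : ℝ),
      c * y ≤ nbhdLength (orbitSet (fun x => x - f x) x₀) (f y) ∧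
      nbhdLength (orbitSet (fun x => x - f x) x₀) (f y) ≤ C * y := by
  obtain ⟨m, hm, hpow⟩ := hsub.exists_mul_rpow_le hfpos
  have hmono := hsub.strictMonoOn hfpos
  have hanti := hx₀.strictAnti hfpos
  -- near `0`, a step of the orbit is at most half of the distance to `0`
  have hhalf : ∀ᶠ x in 𝓝[>] (0 : ℝ), f x ≤ x / 2 := by
    have h1 := (hf0'.mono Ioi_subset_Ici_self).isLittleO.bound (show (0 : ℝ) < 1 / 2 by norm_num)
    filter_upwards [h1, self_mem_nhdsWithin] with x hx hx0
    simp only [hf0, sub_zero, smul_zero, Real.norm_eq_abs, abs_of_pos (mem_Ioi.1 hx0)] at hx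
    linarith [le_abs_self (f x)]
  obtain ⟨δ, hδ, hδf⟩ := mem_nhdsGT_iff_exists_Ioo_subset.1 hhalf
  obtain ⟨n₀, hn₀⟩ := (hx₀.2.eventually_lt_const hδ).exists
  have hC : 0 < 2 ^ (m - 1) / (m - 1) := div_pos (Real.rpow_pos_of_pos two_pos _) (by linarith)
  refine ⟨1 / 2, 2 * (2 ^ (m - 1) / (m - 1)) + 2, by norm_num, by linarith, ?_⟩
  filter_upwards [Ioo_mem_nhdsGT (hx₀.1 n₀).1] with y hy
  have hyd : y ∈ Ioo 0 d := ⟨hy.1, hy.2.trans (hx₀.1 n₀).2⟩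
  have hfy : f y ≤ y / 2 := hδf ⟨hy.1, hy.2.trans hn₀⟩
  have hfy0 := hfpos y hyd
  have hex : ∃ n, (fun x => x - f x)^[n] x₀ < y := (hx₀.2.eventually_lt_const hy.1).exists
  classical
  obtain ⟨hlt, hmin⟩ := And.intro (Nat.find_spec hex) (fun n => Nat.find_min (H := hex) (m := n))
  generalize Nat.find hex = N at hlt hmin
  have hmin' : ∀ n < N, y ≤ (fun x => x - f x)^[n] x₀ := fun n hn => not_lt.1 (hmin n hn)
  have hn₀N : n₀ < N := by
    by_contra! h
    exact absurd hy.2 (not_lt.2 ((hanti.antitone h).trans hlt.le))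
  have hNy : y / 2 ≤ (fun x => x - f x)^[N] x₀ := by
    obtain ⟨K, rfl⟩ : ∃ j, N = j + 1 := ⟨N - 1, by omega⟩
    have h1 := hmin' K (Nat.lt_succ_self K)
    have h2 : (fun x => x - f x)^[K] x₀ ≤ _ := hanti.antitone (Nat.lt_succ_iff.1 hn₀N)
    have h3 : f _ ≤ _ / 2 := hδf ⟨(hx₀.1 K).1, lt_of_le_of_lt h2 hn₀⟩
    rw [orbit_succ]
    linarith
  have hcard := hx₀.card_mul_le hm hpow hyd hmin' hNy
  have hcover := thickening_orbitSet_subset (fun x => x - f x) x₀ (ε := f y) (y := y) (N := N)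
    fun n hn => ⟨(hx₀.1 n).1.le, (hanti.antitone hn).trans hlt.le⟩
  have hfin1 : volume (⋃ n ∈ Finset.range N, Metric.ball ((fun x => x - f x)^[n] x₀) (f y)) ≠ ⊤ :=
    ((measure_biUnion_lt_top (Finset.finite_toSet _)
      fun n _ => measure_ball_lt_top)).ne
  have hfin : volume ((⋃ n ∈ Finset.range N, Metric.ball ((fun x => x - f x)^[n] x₀) (f y)) ∪
      Ioo (-f y) (y + f y)) ≠ ⊤ := measure_union_ne_top hfin1 measure_Ioo_lt_top.ne
  constructor
  · have h1 := measureReal_mono (hx₀.Ioo_subset_thickening hfpos hmono hyd hlt)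
      (measure_ne_top_of_subset hcover hfin)
    rw [Real.volume_real_Ioo_of_le (hx₀.1 N).1.le, sub_zero] at h1
    exact le_trans (by linarith) h1
  · refine (measureReal_mono hcover hfin).trans ((measureReal_union_le _ _).trans ?_)
    have h1 : volume.real (⋃ n ∈ Finset.range N,
        Metric.ball ((fun x => x - f x)^[n] x₀) (f y)) ≤ N * (2 * f y) := by
      refine (measureReal_biUnion_finset_le _ _).trans ?_
      simp [Measure.real, Real.volume_ball, hfy0.le]
    rw [Real.volume_real_Ioo_of_le (by linarith)]
    nlinarith

end Orbit

/-! ### Inverse functions and Minkowski contents -/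

section Inverse

variable {d : ℝ} {v : ℝ → ℝ}

theorem StrictMonoOn.tendsto_nhdsGT_zero (hd : 0 < d) (hmono : StrictMonoOn v (Ioo 0 d))
    (h0 : Tendsto v (𝓝[>] 0) (𝓝 0)) : Tendsto v (𝓝[>] 0) (𝓝[>] 0) :=
  tendsto_nhdsWithin_iff.2 ⟨h0, (eventually_mem_Ioo_nhdsGT_zero hd).mono fun _ hx =>
    hmono.pos_of_tendsto_zero h0 hx⟩

theorem StrictMonoOn.invOn_apply (hmono : StrictMonoOn v (Ioo 0 d)) {x : ℝ} (hx : x ∈ Ioo 0 d) :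
    invOn d v (v x) = x :=
  hmono.injOn.leftInvOn_invFunOn hx

theorem eventually_invOn_mem (hd : 0 < d) (hcont : ContinuousOn v (Ioo 0 d))
    (hmono : StrictMonoOn v (Ioo 0 d)) (h0 : Tendsto v (𝓝[>] 0) (𝓝 0)) :
    ∀ᶠ ε in 𝓝[>] (0 : ℝ), invOn d v ε ∈ Ioo 0 d ∧ v (invOn d v ε) = ε := by
  have hd2 : d / 2 ∈ Ioo 0 d := ⟨by linarith, by linarith⟩
  filter_upwards [Ioo_mem_nhdsGT (hmono.pos_of_tendsto_zero h0 hd2)] with ε hε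
  obtain ⟨x, hx, hxd⟩ := ((h0.eventually_lt_const hε.1).and (Ioo_mem_nhdsGT hd2.1)).exists
  have hsub : Icc x (d / 2) ⊆ Ioo 0 d := fun t ht =>
    ⟨hxd.1.trans_le ht.1, ht.2.trans_lt hd2.2⟩
  obtain ⟨t, ht, hte⟩ := intermediate_value_Icc hxd.2.le (hcont.mono hsub) ⟨hx.le, hε.2.le⟩
  have hex : ∃ a ∈ Ioo 0 d, v a = ε := ⟨t, hsub ht, hte⟩
  exact ⟨Function.invFunOn_mem hex, Function.invFunOn_eq hex⟩

theorem tendsto_invOn (hd : 0 < d) (hcont : ContinuousOn v (Ioo 0 d))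
    (hmono : StrictMonoOn v (Ioo 0 d)) (h0 : Tendsto v (𝓝[>] 0) (𝓝 0)) :
    Tendsto (invOn d v) (𝓝[>] 0) (𝓝[>] 0) := by
  have hmem := eventually_invOn_mem hd hcont hmono h0
  refine tendsto_nhdsWithin_iff.2 ⟨?_, hmem.mono fun _ h => h.1.1⟩
  refine tendsto_order.2 ⟨fun a ha => hmem.mono fun _ h => ha.trans h.1.1, fun a ha => ?_⟩
  have hb : min a d / 2 ∈ Ioo 0 d := by
    have := lt_min ha hd
    exact ⟨by linarith, by linarith [min_le_right a d]⟩
  filter_upwards [hmem, Ioo_mem_nhdsGT (hmono.pos_of_tendsto_zero h0 hb)] with ε hε hε2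
  have h1 : invOn d v ε < min a d / 2 := (hmono.lt_iff_lt hε.1 hb).1 (by rw [hε.2]; exact hε2.2)
  linarith [min_le_left a d, lt_min ha hd]

end Inverse

theorem lowerContent_le_upperContent (d : ℝ) (S : Set ℝ) (v : ℝ → ℝ) :
    lowerContent d S v ≤ upperContent d S v :=
  liminf_le_limsup

/-- The data for comparing `f` with a gauge `v`, and `T` with `v⁻¹`: here `T ε` stands for the length
of the `ε`-neighborhood of an orbit of `id - f`, and all that matters is that `T (f y)` is comparable
with `y`. -/
structure IsGaugePair (d : ℝ) (f v T : ℝ → ℝ) : Prop where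
  pos : 0 < d
  f_pos : ∀ x ∈ Ioo 0 d, 0 < f x
  sublinear : IsSublinear d f
  upper : UpperPowerCondition d f
  f_cont : ContinuousOn f (Ioo 0 d)
  f_zero : Tendsto f (𝓝[>] 0) (𝓝 0)
  v_cont : ContinuousOn v (Ioo 0 d)
  v_mono : StrictMonoOn v (Ioo 0 d)
  v_zero : Tendsto v (𝓝[>] 0) (𝓝 0)
  bounds : ∃ c C : ℝ, 0 < c ∧ 0 < C ∧ ∀ᶠ y in 𝓝[>] (0 : ℝ), c * y ≤ T (f y) ∧ T (f y) ≤ C * y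

namespace IsGaugePair

variable {d : ℝ} {f v T : ℝ → ℝ}

theorem v_pos (h : IsGaugePair d f v T) : ∀ x ∈ Ioo 0 d, 0 < v x := fun _ hx =>
  h.v_mono.pos_of_tendsto_zero h.v_zero hx

/-- For small `ε`, the points `y = f⁻¹(ε)` and `z = v⁻¹(ε)` satisfy `f y = ε = v z`, the point `z`
has any given property `p` that holds near `0`, and `T ε` is comparable with `y`. -/
theorem exists_eventually (h : IsGaugePair d f v T) :
    ∃ c C : ℝ, 0 < c ∧ 0 < C ∧ ∀ p : ℝ → Prop, (∀ᶠ z in 𝓝[>] (0 : ℝ), p z) →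
      ∀ᶠ ε in 𝓝[>] (0 : ℝ), p (invOn d v ε) ∧ invOn d v ε ∈ Ioo 0 d ∧ v (invOn d v ε) = ε ∧
        ∃ y ∈ Ioo 0 d, f y = ε ∧ c * y ≤ T ε ∧ T ε ≤ C * y := by
  obtain ⟨c, C, hc, hC, hb⟩ := h.bounds
  refine ⟨c, C, hc, hC, fun p hp => ?_⟩
  have hfm := h.sublinear.strictMonoOn h.f_pos
  have hf := eventually_invOn_mem h.pos h.f_cont hfm h.f_zero
  filter_upwards [(tendsto_invOn h.pos h.v_cont h.v_mono h.v_zero).eventually hp,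
    eventually_invOn_mem h.pos h.v_cont h.v_mono h.v_zero, hf,
    (tendsto_invOn h.pos h.f_cont hfm h.f_zero).eventually hb] with ε h1 h2 h3 h4
  rw [h3.2] at h4
  exact ⟨h1, h2.1, h2.2, _, h3.1, h3.2, h4⟩

theorem exists_mul_invOn_le (h : IsGaugePair d f v T) {B : ℝ}
    (hB : ∀ᶠ x in 𝓝[>] (0 : ℝ), f x ≤ B * v x) :
    ∃ A : ℝ, 0 < A ∧ ∀ᶠ ε in 𝓝[>] (0 : ℝ), A * invOn d v ε ≤ T ε := by
  obtain ⟨c, C, hc, hC, hev⟩ := h.exists_eventually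
  have hK : (0 : ℝ) < max 1 B := lt_max_of_lt_left one_pos
  refine ⟨c / max 1 B, div_pos hc hK, ?_⟩
  filter_upwards [hev _ hB] with ε ⟨h1, h2, h3, y, hy, hfy, h4, _⟩
  generalize invOn d v ε = z at h1 h2 h3 ⊢
  have h5 : f (z) ≤ max 1 B * f y := by
    rw [h3, ← hfy] at h1
    exact h1.trans (mul_le_mul_of_nonneg_right (le_max_right _ _) (h.f_pos y hy).le)
  have h6 := h.sublinear.le_mul_of_le_mul h.f_pos (le_max_left _ _) h2 hy h5
  rw [div_mul_eq_mul_div, div_le_iff₀ hK]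
  nlinarith

theorem exists_le_mul_invOn (h : IsGaugePair d f v T) {A : ℝ} (hA : 0 < A)
    (hAv : ∀ᶠ x in 𝓝[>] (0 : ℝ), A * v x ≤ f x) :
    ∃ B : ℝ, 0 < B ∧ ∀ᶠ ε in 𝓝[>] (0 : ℝ), T ε ≤ B * invOn d v ε := by
  obtain ⟨c, C, hc, hC, hev⟩ := h.exists_eventually
  have hK : (0 : ℝ) < max 1 A⁻¹ := lt_max_of_lt_left one_pos
  refine ⟨C * max 1 A⁻¹, mul_pos hC hK, ?_⟩
  filter_upwards [hev _ hAv] with ε ⟨h1, h2, h3, y, hy, hfy, _, h4⟩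
  generalize invOn d v ε = z at h1 h2 h3 ⊢
  have h5 : f y ≤ max 1 A⁻¹ * f (z) := by
    rw [h3, ← hfy] at h1
    refine ((le_inv_mul_iff₀ hA).2 h1).trans ?_
    exact mul_le_mul_of_nonneg_right (le_max_right _ _) (h.f_pos _ h2).le
  have h6 := h.sublinear.le_mul_of_le_mul h.f_pos (le_max_left _ _) hy h2 h5
  nlinarith

/-- A property of `ε` that holds for all small `ε` holds for `ε = v z`, for all small `z`. -/
theorem eventually_comp (h : IsGaugePair d f v T) {p : ℝ → ℝ → Prop}
    (hp : ∀ᶠ ε in 𝓝[>] (0 : ℝ), p ε (invOn d v ε)) : ∀ᶠ z in 𝓝[>] (0 : ℝ), p (v z) z := by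
  filter_upwards [(h.v_mono.tendsto_nhdsGT_zero h.pos h.v_zero).eventually hp,
    eventually_mem_Ioo_nhdsGT_zero h.pos] with z hz hzd
  rwa [h.v_mono.invOn_apply hzd] at hz

theorem exists_le_mul_of_mul_invOn_le (h : IsGaugePair d f v T) {A : ℝ} (hA : 0 < A)
    (hAT : ∀ᶠ ε in 𝓝[>] (0 : ℝ), A * invOn d v ε ≤ T ε) :
    ∃ B : ℝ, 0 < B ∧ ∀ᶠ x in 𝓝[>] (0 : ℝ), f x ≤ B * v x := by
  obtain ⟨c, C, hc, hC, hev⟩ := h.exists_eventually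
  obtain ⟨M, _, hM⟩ := h.upper.exists_le_rpow_mul h.sublinear h.f_pos
  have hK : (0 : ℝ) < max 1 (C / A) := lt_max_of_lt_left one_pos
  refine ⟨max 1 (C / A) ^ M, Real.rpow_pos_of_pos hK M,
    h.eventually_comp (p := fun ε z => f z ≤ max 1 (C / A) ^ M * ε) ?_⟩
  filter_upwards [hAT, hev _ (Eventually.of_forall fun _ => trivial)]
    with ε h1 ⟨_, h2, h3, y, hy, hfy, _, h4⟩
  generalize invOn d v ε = z at h1 h2 h3 ⊢
  rw [← hfy]
  refine hM _ (le_max_left _ _) _ h2 y hy ?_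
  refine le_trans ?_ (mul_le_mul_of_nonneg_right (le_max_right 1 (C / A)) hy.1.le)
  rw [div_mul_eq_mul_div, le_div_iff₀ hA]
  linarith

theorem exists_mul_le_of_le_mul_invOn (h : IsGaugePair d f v T) {B : ℝ}
    (hBT : ∀ᶠ ε in 𝓝[>] (0 : ℝ), T ε ≤ B * invOn d v ε) :
    ∃ A : ℝ, 0 < A ∧ ∀ᶠ x in 𝓝[>] (0 : ℝ), A * v x ≤ f x := by
  obtain ⟨c, C, hc, hC, hev⟩ := h.exists_eventually
  obtain ⟨M, _, hM⟩ := h.upper.exists_le_rpow_mul h.sublinear h.f_pos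
  have hK : (0 : ℝ) < max 1 (B / c) := lt_max_of_lt_left one_pos
  refine ⟨(max 1 (B / c) ^ M)⁻¹, inv_pos.2 (Real.rpow_pos_of_pos hK M),
    h.eventually_comp (p := fun ε z => (max 1 (B / c) ^ M)⁻¹ * ε ≤ f z) ?_⟩
  filter_upwards [hBT, hev _ (Eventually.of_forall fun _ => trivial)]
    with ε h1 ⟨_, h2, h3, y, hy, hfy, h4, _⟩
  generalize invOn d v ε = z at h1 h2 h3 ⊢
  rw [← hfy, inv_mul_le_iff₀ (Real.rpow_pos_of_pos hK M)]
  refine hM _ (le_max_left _ _) y hy _ h2 ?_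
  refine le_trans ?_ (mul_le_mul_of_nonneg_right (le_max_right 1 (B / c)) h2.1.le)
  rw [div_mul_eq_mul_div, le_div_iff₀ hc]
  linarith

theorem comparable_iff (h : IsGaugePair d f v T) :
    Comparable f v ↔ Comparable T (invOn d v) := by
  have hvpos : ∀ᶠ x in 𝓝[>] (0 : ℝ), 0 < v x :=
    (eventually_mem_Ioo_nhdsGT_zero h.pos).mono h.v_pos
  have hipos : ∀ᶠ ε in 𝓝[>] (0 : ℝ), 0 < invOn d v ε :=
    (eventually_invOn_mem h.pos h.v_cont h.v_mono h.v_zero).mono fun _ h => h.1.1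
  constructor
  · rintro ⟨A, B, hA, hB, hAB⟩
    obtain ⟨A', hA', h1⟩ := h.exists_mul_invOn_le (B := B) (by
      filter_upwards [hAB, hvpos] with x hx hx0 using (div_le_iff₀ hx0).1 hx.2)
    obtain ⟨B', hB', h2⟩ := h.exists_le_mul_invOn hA (by
      filter_upwards [hAB, hvpos] with x hx hx0 using (le_div_iff₀ hx0).1 hx.1)
    refine ⟨A', B', hA', hB', ?_⟩
    filter_upwards [h1, h2, hipos] with ε h1 h2 h0
    exact ⟨(le_div_iff₀ h0).2 h1, (div_le_iff₀ h0).2 h2⟩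
  · rintro ⟨A, B, hA, hB, hAB⟩
    obtain ⟨B', hB', h1⟩ := h.exists_le_mul_of_mul_invOn_le hA (by
      filter_upwards [hAB, hipos] with x hx hx0 using (le_div_iff₀ hx0).1 hx.1)
    obtain ⟨A', hA', h2⟩ := h.exists_mul_le_of_le_mul_invOn (B := B) (by
      filter_upwards [hAB, hipos] with x hx hx0 using (div_le_iff₀ hx0).1 hx.2)
    refine ⟨A', B', hA', hB', ?_⟩
    filter_upwards [h1, h2, hvpos] with ε h1 h2 h0
    exact ⟨(le_div_iff₀ h0).2 h2, (div_le_iff₀ h0).2 h1⟩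

theorem lowerContent_pos {S : Set ℝ} (h : IsGaugePair d f v (nbhdLength S)) {B : ℝ}
    (hB : ∀ᶠ x in 𝓝[>] (0 : ℝ), f x ≤ B * v x) : 0 < lowerContent d S v := by
  obtain ⟨A, hA, hAT⟩ := h.exists_mul_invOn_le hB
  refine lt_of_lt_of_le (ENNReal.ofReal_pos.2 hA) (le_liminf_of_le (by isBoundedDefault) ?_)
  filter_upwards [hAT, eventually_invOn_mem h.pos h.v_cont h.v_mono h.v_zero] with ε h1 h2
  rw [ENNReal.le_div_iff_mul_le (Or.inl (ENNReal.ofReal_pos.2 h2.1.1).ne')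
    (Or.inl ENNReal.ofReal_ne_top), ← ENNReal.ofReal_mul hA.le]
  exact (ENNReal.ofReal_le_ofReal h1).trans ENNReal.ofReal_toReal_le

theorem upperContent_eq_zero {S : Set ℝ} (h : IsGaugePair d f v (nbhdLength S))
    (h0 : Tendsto (fun x => v x / f x) (𝓝[>] 0) (𝓝 0)) : upperContent d S v = 0 := by
  obtain ⟨c, C, hc, hC, hev⟩ := h.exists_eventually
  obtain ⟨M, _, hM⟩ := h.upper.exists_le_rpow_mul h.sublinear h.f_pos
  have hle : ∀ K : ℝ, 1 ≤ K → upperContent d S v ≤ ENNReal.ofReal (C / K) := by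
    intro K hK
    have hK0 : 0 < K := one_pos.trans_le hK
    have hKM := Real.rpow_pos_of_pos hK0 M
    refine limsup_le_of_le (by isBoundedDefault) ?_
    filter_upwards [hev _ (h0.eventually_lt_const (inv_pos.2 hKM))]
      with ε ⟨h1, h2, h3, y, hy, hfy, h4, h5⟩
    generalize invOn d v ε = z at h1 h2 h3 ⊢
    -- if `z ≤ K y` then `f z ≤ K ^ M f y = K ^ M v z`, against the choice of `ε`
    have h6 : K * y < z := by
      by_contra! hcon
      have h7 := hM K hK _ h2 y hy hcon
      rw [div_lt_iff₀ (h.f_pos _ h2), h3, ← hfy, lt_inv_mul_iff₀ hKM] at h1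
      exact absurd h7 (not_le.2 h1)
    have hTpos : 0 < nbhdLength S ε := (mul_pos hc hy.1).trans_le h4
    have hfin : volume (Metric.thickening ε S) ≠ ⊤ := fun htop => by
      simp [nbhdLength, Measure.real, htop] at hTpos
    refine ENNReal.div_le_of_le_mul ?_
    rw [← ENNReal.ofReal_mul (div_pos hC hK0).le, ← ENNReal.ofReal_toReal hfin]
    refine ENNReal.ofReal_le_ofReal (h5.trans ?_)
    rw [div_mul_eq_mul_div, le_div_iff₀ hK0]
    nlinarith
  refine le_antisymm (ge_of_tendsto (f := fun K : ℝ => ENNReal.ofReal (C / K)) (x := atTop) ?_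
    ((eventually_ge_atTop 1).mono hle)) zero_le
  have := ENNReal.tendsto_ofReal (tendsto_const_nhds.div_atTop tendsto_id :
    Tendsto (fun K : ℝ => C / K) atTop (𝓝 0))
  rwa [ENNReal.ofReal_zero] at this

end IsGaugePair

/-! ### Upper bound for the multiplicity -/

/-- `x 0 < x 1 < ... < x (n - 1)` are zeros of `h` in `I`; the values `x a` with `a ≥ n` are ignored. -/
structure IsZeroList (h : ℝ → ℝ) (I : Set ℝ) (n : ℕ) (x : ℕ → ℝ) : Prop where
  lt : ∀ a b, a < b → b < n → x a < x b
  mem : ∀ a < n, x a ∈ I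
  zero : ∀ a < n, h (x a) = 0

theorem exists_isZeroList_of_injective {h : ℝ → ℝ} {I : Set ℝ} {n : ℕ} {y : Fin n → ℝ}
    (hy : Function.Injective y) (hI : ∀ j, y j ∈ I) (h0 : ∀ j, h (y j) = 0) :
    ∃ x, IsZeroList h I n x := by
  classical
  have hcard : (Finset.univ.image y).card = n := by
    rw [Finset.card_image_of_injective _ hy, Finset.card_univ, Fintype.card_fin]
  set s := (Finset.univ.image y).orderEmbOfFin hcard with hs
  have hmem : ∀ j, ∃ i, y i = s j := fun j =>
    (Finset.mem_image.1 (Finset.orderEmbOfFin_mem (Finset.univ.image y) hcard j)).imp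
      fun _ h => h.2
  refine ⟨fun a => if ha : a < n then s ⟨a, ha⟩ else 0, ⟨fun a b hab hb => ?_, fun a ha => ?_,
    fun a ha => ?_⟩⟩
  · simp only [dif_pos hb, dif_pos (hab.trans hb)]
    exact s.strictMono hab
  · obtain ⟨i, hi⟩ := hmem ⟨a, ha⟩
    simp only [dif_pos ha, ← hi, hI]
  · obtain ⟨i, hi⟩ := hmem ⟨a, ha⟩
    simp only [dif_pos ha, ← hi, h0]

theorem IsZeroList.exists_deriv {h : ℝ → ℝ} {δ : ℝ} {n : ℕ} {x : ℕ → ℝ}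
    (hx : IsZeroList h (Ioo 0 δ) (n + 1) x) (hd : DifferentiableOn ℝ h (Ioo 0 δ)) :
    ∃ y, IsZeroList (deriv h) (Ioo 0 δ) n y := by
  have hex : ∀ a, ∃ c, a < n → c ∈ Ioo (x a) (x (a + 1)) ∧ deriv h c = 0 := by
    intro a
    by_cases ha : a < n
    · have hsub : Icc (x a) (x (a + 1)) ⊆ Ioo 0 δ := fun t ht =>
        ⟨(hx.mem a (by omega)).1.trans_le ht.1, ht.2.trans_lt (hx.mem (a + 1) (by omega)).2⟩
      obtain ⟨c, hc, hc0⟩ := exists_deriv_eq_zero (hx.lt a (a + 1) (by omega) (by omega))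
        (hd.continuousOn.mono hsub)
        ((hx.zero a (by omega)).trans (hx.zero (a + 1) (by omega)).symm)
      exact ⟨c, fun _ => ⟨hc, hc0⟩⟩
    · exact ⟨0, fun h => absurd h ha⟩
  choose c hc using hex
  refine ⟨c, ⟨fun a b hab hb => ?_, fun a ha => ?_, fun a ha => (hc a ha).2⟩⟩
  · have h1 : x (a + 1) ≤ x b := by
      rcases eq_or_lt_of_le (Nat.succ_le_of_lt hab) with h | h
      · rw [← h]
      · exact (hx.lt _ _ h (by omega)).le
    exact ((hc a (hab.trans hb)).1.2.trans_le h1).trans (hc b hb).1.1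
  · exact ⟨(hx.mem a (by omega)).1.trans (hc a ha).1.1,
      (hc a ha).1.2.trans (hx.mem (a + 1) (by omega)).2⟩

/-- Rolle's theorem for generalized derivatives: each of them costs at most one zero. -/
theorem IsZeroList.exists_genDeriv {d δ : ℝ} {u : ℕ → ℝ → ℝ} {h : ℝ → ℝ} {ℓ : ℕ}
    (hδ : δ ≤ d) (hd : ∀ i < ℓ, DifferentiableOn ℝ (genDeriv u i h) (Ioo 0 d)) :
    ∀ i ≤ ℓ, ∀ n x, IsZeroList h (Ioo 0 δ) (n + i) x →
      ∃ y, IsZeroList (genDeriv u i h) (Ioo 0 δ) n y := by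
  intro i
  induction i with
  | zero =>
    intro _ n x hx
    exact ⟨x, hx.lt, hx.mem, fun a ha => by simp [genDeriv, hx.zero a ha]⟩
  | succ i ih =>
    intro hi n x hx
    obtain ⟨y, hy⟩ := ih (by omega) (n + 1) x (by rwa [show n + 1 + i = n + (i + 1) by ring])
    obtain ⟨z, hz⟩ := hy.exists_deriv ((hd i (by omega)).mono (Ioo_subset_Ioo_right hδ))
    exact ⟨z, hz.lt, hz.mem, fun a ha => by simp [genDeriv, hz.zero a ha]⟩

section Multiplicity

variable {Λ : Type*} [TopologicalSpace Λ] {d : ℝ} {r L : ℕ∞} {ℓ : ℕ} {u : Λ → ℕ → ℝ → ℝ}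
  {f : Λ → ℝ → ℝ} {α : ℕ → Λ → ℝ} {p₀ : Λ}

theorem HasUniformDevelopment.hasGenDerivAtZero (hdev : HasUniformDevelopment d u ℓ f α) {j : ℕ}
    (hj : j ≤ ℓ) (p : Λ) : HasGenDerivAtZero (u p) j (f p) (α j p) :=
  (hdev.uniform j hj).tendsto_at p

theorem HasUniformDevelopment.differentiableOn_genDeriv (hdev : HasUniformDevelopment d u ℓ f α)
    (hscale : ∀ p, IsChebyshevScale r L d (u p)) (hℓ : (ℓ : ℕ∞) ≤ L) (p : Λ) {i : ℕ} (hi : i < ℓ) :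
    DifferentiableOn ℝ (genDeriv (u p) i (f p)) (Ioo 0 d) :=
  (hdev.development p).differentiableOn_genDeriv (hscale p) hℓ hi

/-- If the first `j` coefficients of `f_p` vanish, then `f_p / u_j` has the limit `α_j (p)` at `0`. -/
theorem HasUniformDevelopment.tendsto_div (hdev : HasUniformDevelopment d u ℓ f α)
    (hscale : ∀ p, IsChebyshevScale r L d (u p)) (hd : 0 < d) (hℓ : (ℓ : ℕ∞) ≤ L) {j : ℕ}
    (hj : j ≤ ℓ) {p : Λ} (h0 : ∀ i < j, α i p = 0) :
    Tendsto (fun x => f p x / u p j x) (𝓝[>] 0) (𝓝 (α j p)) :=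
  (hscale p).tendsto_div hd (le_trans (by exact_mod_cast hj) hℓ)
    (fun _ hi => hdev.differentiableOn_genDeriv hscale hℓ p (hi.trans_le hj))
    (fun i hi => by simpa [h0 i hi] using hdev.hasGenDerivAtZero (hi.le.trans hj) p)
    (hdev.hasGenDerivAtZero hj p)

/-- If `D_j f_{p₀} (0) ≠ 0`, then `D_j f_p` has no zeros near `0` for `p` near `p₀`, so that `f_p`
has at most `j` zeros there. -/
theorem HasUniformDevelopment.zeroMultiplicity_le (hdev : HasUniformDevelopment d u ℓ f α)
    (hscale : ∀ p, IsChebyshevScale r L d (u p)) (hd : 0 < d) (hℓ : (ℓ : ℕ∞) ≤ L) {j : ℕ}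
    (hj : j ≤ ℓ) (hα : α j p₀ ≠ 0) : zeroMultiplicity d f p₀ ≤ j := by
  refine iSup₂_le fun m hm => ?_
  by_contra! hjm
  have hjm' : j < m := by exact_mod_cast hjm
  obtain ⟨p, y, hp, hy, hlim⟩ := hm
  have hα2 : 0 < |α j p₀| / 2 := half_pos (abs_pos.2 hα)
  have hunif := Metric.tendstoUniformly_iff.1 (hdev.uniform j hj) _ hα2
  obtain ⟨δ, hδ, hδf⟩ := mem_nhdsGT_iff_exists_Ioo_subset.1 hunif
  have hp' : ∀ᶠ n in atTop, |α j p₀| / 2 < |α j (p n)| :=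
    ((hdev.continuous_zero j hj).abs.tendsto p₀ |>.comp hp).eventually_const_lt
      (half_lt_self (abs_pos.2 hα))
  have hlim' : ∀ᶠ n in atTop, ∀ i, y n i < min δ d :=
    eventually_all.2 fun i => (hlim i).eventually_lt_const (lt_min hδ hd)
  obtain ⟨n, hn1, hn2⟩ := (hp'.and hlim').exists
  obtain ⟨x, hx⟩ := exists_isZeroList_of_injective (h := f (p n)) (I := Ioo 0 (min δ d)) (hy n).1
    (fun i => ⟨lt_of_le_of_ne ((hy n).2 i).1.1 ((hy n).2 i).2.1.symm, hn2 i⟩)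
    (fun i => ((hy n).2 i).2.2)
  obtain ⟨z, hz⟩ := IsZeroList.exists_genDeriv (min_le_right δ d)
    (fun i hi => hdev.differentiableOn_genDeriv hscale hℓ (p n) hi) j hj (m - j) x
    (by rwa [Nat.sub_add_cancel hjm'.le])
  have h0 := hz.mem 0 (by omega)
  have h1 := hδf ⟨h0.1, h0.2.trans_le (min_le_left δ d)⟩ (p n)
  rw [hz.zero 0 (by omega), Real.dist_eq, sub_zero] at h1
  exact lt_asymm h1 hn1

/-! ### Lower bound for the multiplicity -/

/-- `h` takes nonzero values of alternating signs at the points `z 0 > z 1 > ... > z n` of `(0,δ)`. The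
list grows towards `0`. -/
structure IsAlternating (h : ℝ → ℝ) (δ : ℝ) (n : ℕ) (z : ℕ → ℝ) : Prop where
  lt : ∀ a < n, z (a + 1) < z a
  mem : ∀ a ≤ n, z a ∈ Ioo 0 δ
  neg : ∀ a < n, h (z a) * h (z (a + 1)) < 0
  ne : h (z n) ≠ 0

theorem mul_neg_of_mul_pos_of_mul_neg {a b a' b' : ℝ} (ha : 0 < a' * a) (hb : 0 < b' * b)
    (hab : a * b < 0) : a' * b' < 0 := by
  by_contra! h
  have h1 := mul_pos ha hb
  have h2 := mul_nonpos_of_nonneg_of_nonpos h hab.le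
  have h3 : a' * a * (b' * b) = a' * b' * (a * b) := by ring
  linarith

theorem IsAlternating.exists_injective_zeros {h : ℝ → ℝ} {δ : ℝ} {n : ℕ} {z : ℕ → ℝ}
    (hz : IsAlternating h δ n z) (hc : ContinuousOn h (Ioo 0 δ)) :
    ∃ y : Fin n → ℝ, Function.Injective y ∧ ∀ j, y j ∈ Ioo 0 δ ∧ h (y j) = 0 := by
  have hex : ∀ j : Fin n, ∃ c ∈ Ioo (z (j + 1)) (z j), h c = 0 := by
    intro j
    have hlt := hz.lt j j.2
    have hsub : Icc (z (j + 1)) (z j) ⊆ Ioo 0 δ := fun t ht =>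
      ⟨(hz.mem (j + 1) j.2).1.trans_le ht.1, ht.2.trans_lt (hz.mem j j.2.le).2⟩
    rcases mul_neg_iff.1 (hz.neg j j.2) with ⟨h1, h2⟩ | ⟨h1, h2⟩
    · exact intermediate_value_Ioo hlt.le (hc.mono hsub) ⟨h2, h1⟩
    · exact intermediate_value_Ioo' hlt.le (hc.mono hsub) ⟨h1, h2⟩
  choose y hy hy0 using hex
  have hanti : StrictAnti y := by
    intro i j hij
    refine (hy j).2.trans_le (le_trans ?_ (hy i).1.le)
    have hle : ∀ b, (i : ℕ) + 1 ≤ b → b ≤ n → z b ≤ z (i + 1) := by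
      intro b hb
      induction b, hb using Nat.le_induction with
      | base => exact fun _ => le_rfl
      | succ b _ ih => exact fun hbn => (hz.lt b (by omega)).le.trans (ih (by omega))
    exact hle j (Nat.succ_le_of_lt hij) j.2.le
  exact ⟨y, hanti.injective, fun j => ⟨⟨(hz.mem (j + 1) j.2).1.trans (hy j).1,
    (hy j).2.trans (hz.mem j j.2.le).2⟩, hy0 j⟩⟩

/-- If `α_i (p) = 0` for `i < j` and `α_j (p) ≠ 0`, then `D_0 f_p` has the sign of `α_j (p)` near
`0`. -/
theorem HasUniformDevelopment.eventually_mul_pos (hdev : HasUniformDevelopment d u ℓ f α)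
    (hscale : ∀ p, IsChebyshevScale r L d (u p)) (hd : 0 < d) (hℓ : (ℓ : ℕ∞) ≤ L) {j : ℕ}
    (hj : j ≤ ℓ) {p : Λ} (h0 : ∀ i < j, α i p = 0) (hα : α j p ≠ 0) :
    ∀ᶠ x in 𝓝[>] (0 : ℝ), 0 < genDeriv (u p) 0 (f p) x * α j p := by
  have hjL : (j : ℕ∞) ≤ L := le_trans (by exact_mod_cast hj) hℓ
  have hlim := hdev.tendsto_div hscale hd hℓ hj h0
  have hpos := (hlim.mul_const (α j p)).eventually_const_lt (mul_self_pos.2 hα)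
  filter_upwards [hpos, eventually_mem_Ioo_nhdsGT_zero hd] with x hx hxd
  have huj := (hscale p).genDeriv_pos (Nat.zero_le j) hjL x hxd
  have hne : u p j x ≠ 0 := fun h => by simp [genDeriv, h] at huj
  have heq : genDeriv (u p) 0 (f p) x = f p x / u p j x * genDeriv (u p) 0 (u p j) x := by
    simp only [genDeriv]
    field_simp
  rw [heq, mul_right_comm]
  exact mul_pos hx huj

/-- If the map `(α_0, ..., α_{K-1})` is open at the points of `W`, the first `n` of the coefficients
`α_{K-1}, α_{K-2}, ...` can be given successively much smaller values of suitable signs; each of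
them adds a sign change of `D_0 f_p` near `0`. -/
theorem HasUniformDevelopment.exists_isAlternating (hdev : HasUniformDevelopment d u ℓ f α)
    (hscale : ∀ p, IsChebyshevScale r L d (u p)) (hd : 0 < d) (hℓ : (ℓ : ℕ∞) ≤ L) {K : ℕ}
    (hK : K ≤ ℓ + 1) {W : Set Λ} (hW : IsOpen W) (hp₀ : p₀ ∈ W)
    (hopen : ∀ p ∈ W, 𝓝 (fun i : Fin K => α i p) ≤ map (fun p (i : Fin K) => α i p) (𝓝 p))
    (h0 : ∀ i < K, α i p₀ = 0) {δ : ℝ} (hδ : 0 < δ) (hδd : δ ≤ d)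
    (hne : ∀ x ∈ Ioo 0 d, genDeriv (u p₀) 0 (f p₀) x ≠ 0) :
    ∀ n ≤ K, ∃ p ∈ W, (∀ i, i + n < K → α i p = 0) ∧
      ∃ z, IsAlternating (genDeriv (u p) 0 (f p)) δ n z := by
  intro n
  induction n with
  | zero =>
    intro _
    refine ⟨p₀, hp₀, fun i hi => h0 i hi, fun _ => δ / 2, ⟨by simp, fun _ _ => ?_, by simp,
      hne _ ⟨by linarith, by linarith⟩⟩⟩
    exact ⟨by linarith, by linarith⟩
  | succ n ih =>
    intro hn
    obtain ⟨p, hpW, hαp, z, hz⟩ := ih (by omega)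
    set s := genDeriv (u p) 0 (f p) (z n) with hs
    have hs0 : s ≠ 0 := hz.ne
    have hval : ∀ a ≤ n, genDeriv (u p) 0 (f p) (z a) ≠ 0 := by
      intro a ha
      rcases eq_or_lt_of_le ha with rfl | h
      · exact hs0
      · exact left_ne_zero_of_mul (hz.neg a h).ne
    -- the signs at the old points persist under small perturbations
    have hQ : ∀ᶠ q in 𝓝 p, q ∈ W ∧ ∀ a ∈ Finset.range (n + 1),
        0 < genDeriv (u q) 0 (f q) (z a) * genDeriv (u p) 0 (f p) (z a) := by
      refine (hW.eventually_mem hpW).and ((Finset.range (n + 1)).eventually_all.2 fun a ha => ?_)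
      have ha' : a ≤ n := Finset.mem_range_succ_iff.1 ha
      have hza := hz.mem a ha'
      exact (((hdev.continuous_pos 0 (Nat.zero_le ℓ) (z a)
        ⟨hza.1, hza.2.trans_le hδd⟩).tendsto p).mul_const _).eventually_const_lt
          (mul_self_pos.2 (hval a ha'))
    -- the next coefficient gets the sign opposite to that of the value at the last point
    set j : Fin K := ⟨K - 1 - n, by omega⟩ with hj
    have hcurve : Tendsto (fun t : ℝ => (fun i : Fin K => α i p) + t • Pi.single j (-s)) (𝓝[>] 0)
        (𝓝 fun i : Fin K => α i p) := by
      have hc : Continuous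
          fun t : ℝ => (fun i : Fin K => α i p) + t • (Pi.single j (-s) : Fin K → ℝ) := by
        fun_prop
      have h1 := hc.tendsto 0
      rw [zero_smul, add_zero] at h1
      exact h1.mono_left nhdsWithin_le_nhds
    obtain ⟨t, ⟨q, hq, hqt⟩, ht⟩ :=
      ((hcurve.eventually (hopen p hpW (image_mem_map hQ))).and self_mem_nhdsWithin).exists
    have hqi : ∀ i : Fin K, α i q = α i p + t * (Pi.single j (-s) : Fin K → ℝ) i := fun i =>
      congrFun hqt i
    have hq0 : ∀ i, i + (n + 1) < K → α i q = 0 := by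
      intro i hi
      have hij : (⟨i, by omega⟩ : Fin K) ≠ j := by
        intro h
        have := congrArg Fin.val h
        simp only [hj] at this
        omega
      have h1 := hqi ⟨i, by omega⟩
      rwa [Pi.single_eq_of_ne hij, mul_zero, add_zero, hαp i (by omega)] at h1
    have hqj : α (K - 1 - n) q = t * (-s) := by
      have h1 := hqi j
      rwa [Pi.single_eq_same, hαp (j : ℕ) (by simp only [hj]; omega), zero_add] at h1
    have hqj0 : α (K - 1 - n) q ≠ 0 := by
      rw [hqj]
      exact mul_ne_zero (mem_Ioi.1 ht).ne' (neg_ne_zero.2 hs0)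
    have hsign := hdev.eventually_mul_pos hscale hd hℓ (j := K - 1 - n) (by omega)
      (fun i hi => hq0 i (by omega)) hqj0
    obtain ⟨x, hx, hxI⟩ := (hsign.and (Ioo_mem_nhdsGT (hz.mem n le_rfl).1)).exists
    have hold : ∀ a ≤ n, 0 < genDeriv (u q) 0 (f q) (z a) * genDeriv (u p) 0 (f p) (z a) :=
      fun a ha => hq.2 a (Finset.mem_range_succ_iff.2 ha)
    have hz' : ∀ a ≤ n, Function.update z (n + 1) x a = z a := fun a ha =>
      Function.update_of_ne (by omega) _ _
    have hlast : Function.update z (n + 1) x (n + 1) = x := Function.update_self _ _ _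
    refine ⟨q, hq.1, hq0, Function.update z (n + 1) x, ⟨fun a ha => ?_, fun a ha => ?_,
      fun a ha => ?_, ?_⟩⟩
    · rw [hz' a (by omega)]
      rcases eq_or_lt_of_le (Nat.lt_succ_iff.1 ha) with rfl | h
      · rw [hlast]
        exact hxI.2
      · rw [hz' (a + 1) h]
        exact hz.lt a h
    · rcases eq_or_lt_of_le ha with rfl | h
      · rw [hlast]
        exact ⟨hxI.1, hxI.2.trans (hz.mem n le_rfl).2⟩
      · rw [hz' a (by omega)]
        exact hz.mem a (by omega)
    · rw [hz' a (by omega)]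
      rcases eq_or_lt_of_le (Nat.lt_succ_iff.1 ha) with rfl | h
      · rw [hlast]
        refine mul_neg_of_mul_pos_of_mul_neg (hold a le_rfl) hx ?_
        rw [hqj, ← hs]
        have := mul_pos (mem_Ioi.1 ht) (mul_self_pos.2 hs0)
        linarith [show s * (t * -s) = -(t * (s * s)) by ring]
      · rw [hz' (a + 1) h]
        exact mul_neg_of_mul_pos_of_mul_neg (hold a (by omega)) (hold (a + 1) h) (hz.neg a h)
    · rw [hlast]
      exact left_ne_zero_of_mul hx.ne'

theorem HasUniformDevelopment.le_zeroMultiplicity [(𝓝 p₀).IsCountablyGenerated]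
    (hdev : HasUniformDevelopment d u ℓ f α) (hscale : ∀ p, IsChebyshevScale r L d (u p))
    (hd : 0 < d) (hℓ : (ℓ : ℕ∞) ≤ L) (hℓ0 : 0 < ℓ) {K : ℕ} (hK : K ≤ ℓ + 1)
    (hopen : ∀ᶠ p in 𝓝 p₀,
      𝓝 (fun i : Fin K => α i p) ≤ map (fun p (i : Fin K) => α i p) (𝓝 p))
    (h0 : ∀ i < K, α i p₀ = 0) (hne : ∀ x ∈ Ioo 0 d, f p₀ x ≠ 0) :
    (K : ℕ∞) ≤ zeroMultiplicity d f p₀ := by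
  refine le_iSup₂_of_le K ?_ le_rfl
  obtain ⟨V, hV⟩ := (𝓝 p₀).exists_antitone_basis
  have hex : ∀ n : ℕ, ∃ p ∈ V n, ∃ y : Fin K → ℝ, Function.Injective y ∧
      ∀ j, y j ∈ Ioo 0 (d / (n + 1)) ∧ f p (y j) = 0 := by
    intro n
    obtain ⟨W, hW, hWo, hpW⟩ := eventually_nhds_iff.1 (hopen.and (hV.mem n))
    have hn : (0 : ℝ) < n + 1 := by positivity
    have hδd : d / (n + 1) ≤ d := div_le_self hd.le (by simp)
    obtain ⟨p, hp, -, z, hz⟩ := hdev.exists_isAlternating hscale hd hℓ hK hWo hpW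
      (fun p hp => (hW p hp).1) h0 (div_pos hd hn) hδd
      (fun x hx => div_ne_zero (hne x hx) ((hscale p₀).zero_ne x hx)) K le_rfl
    obtain ⟨y, hy, hy0⟩ := hz.exists_injective_zeros
      ((hdev.differentiableOn_genDeriv hscale hℓ p hℓ0).continuousOn.mono
        (Ioo_subset_Ioo_right hδd))
    refine ⟨p, (hW p hp).2, y, hy, fun j => ⟨(hy0 j).1, ?_⟩⟩
    exact (div_eq_zero_iff.1 (hy0 j).2).resolve_right
      ((hscale p).zero_ne _ ⟨(hy0 j).1.1, (hy0 j).1.2.trans_le hδd⟩)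
  choose p hp y hy hy0 using hex
  refine ⟨p, y, hV.tendsto hp, fun n => ⟨hy n, fun j => ?_⟩, fun j => ?_⟩
  · obtain ⟨⟨h1, h2⟩, h3⟩ := hy0 n j
    exact ⟨⟨h1.le, h2.trans_le (div_le_self hd.le (by simp))⟩, h1.ne', h3⟩
  · refine squeeze_zero (fun n => (hy0 n j).1.1.le) (fun n => (hy0 n j).1.2.le) ?_
    exact tendsto_const_nhds.div_atTop
      (tendsto_atTop_add_const_right _ _ tendsto_natCast_atTop_atTop)

end Multiplicity

/-! ### Maximal rank and local surjectivity -/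

theorem Matrix.rank_eq_card_iff_det_ne_zero {n : ℕ} (A : Matrix (Fin n) (Fin n) ℝ) :
    A.rank = n ↔ A.det ≠ 0 := by
  constructor
  · intro h
    have htop : LinearMap.range A.mulVecLin = ⊤ :=
      Submodule.eq_top_of_finrank_eq (by rw [← Matrix.rank, h]; simp)
    have hunit : IsUnit A := Matrix.mulVec_surjective_iff_isUnit.1 (LinearMap.range_eq_top.1 htop)
    exact ((Matrix.isUnit_iff_isUnit_det A).1 hunit).ne_zero
  · intro h
    simpa using Matrix.rank_of_det_ne_zero h

/-- Near a point where `a_0, ..., a_{n-1}` have maximal rank, the map `(a_0, ..., a_{K-1})`, `K ≤ n`,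
is a submersion. -/
theorem MaximalRankAt.eventually_map_nhds {N : ℕ} {a : ℕ → (Fin N → ℝ) → ℝ} {q : Fin N → ℝ}
    {n K : ℕ} (h : MaximalRankAt a q n) (hK : K ≤ n) :
    ∀ᶠ q' in 𝓝 q, map (fun q (i : Fin K) => a i q) (𝓝 q') = 𝓝 fun i : Fin K => a i q' := by
  obtain ⟨hsmooth, hN, hrank⟩ := h
  have hcd : ∀ᶠ q' in 𝓝 q, ∀ i : Fin n, ContDiffAt ℝ 1 (a i) q' :=
    eventually_all.2 fun i => (hsmooth i i.2).eventually (by simp)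
  have hcont : ContinuousAt (fun q' => (Matrix.of (fun i j : Fin n =>
      fderiv ℝ (a i) q' (Pi.single (Fin.castLE hN j) 1))).det) q := by
    refine ContinuousAt.comp (g := fun A : Matrix (Fin n) (Fin n) ℝ => A.det)
      (continuous_id.matrix_det).continuousAt ?_
    refine continuousAt_pi.2 fun i => continuousAt_pi.2 fun j => ?_
    exact (((hsmooth i i.2).fderiv_right (m := 0) (by simp)).continuousAt).clm_apply
      continuousAt_const
  have hdet := hcont.eventually_ne ((Matrix.rank_eq_card_iff_det_ne_zero _).1 hrank)
  filter_upwards [hcd, hdet] with q' hc hA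
  have hstrict : HasStrictFDerivAt (fun q (i : Fin K) => a i q)
      (ContinuousLinearMap.pi fun i : Fin K => fderiv ℝ (a i) q') q' :=
    hasStrictFDerivAt_pi.2 fun i =>
      (hc (Fin.castLE hK i)).hasStrictFDerivAt (by simp)
  refine hstrict.map_nhds_eq_of_surj (LinearMap.range_eq_top.2 fun w => ?_)
  -- a target in `ℝ^K` is extended by zero and attained on the span of the first `n` coordinates
  have hsurj := Matrix.mulVec_surjective_iff_isUnit.2
    ((Matrix.isUnit_iff_isUnit_det _).2 (isUnit_iff_ne_zero.2 hA))
  obtain ⟨c, hc'⟩ := hsurj fun i : Fin n => if hi : (i : ℕ) < K then w ⟨i, hi⟩ else 0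
  refine ⟨∑ j, c j • Pi.single (Fin.castLE hN j) 1, funext fun i => ?_⟩
  have hi := congrFun hc' (Fin.castLE hK i)
  simp only [Fin.val_castLE, i.2, dif_pos, Matrix.mulVec, dotProduct, Matrix.of_apply] at hi
  rw [← hi]
  simp [map_sum, mul_comm]

theorem eventually_nhds_le_map_of_isEmbedding {Λ : Type*} [TopologicalSpace Λ] {N : ℕ}
    {e : Λ → Fin N → ℝ} (he : IsEmbedding e) {p₀ : Λ} (hrange : range e ∈ 𝓝 (e p₀))
    {a : ℕ → (Fin N → ℝ) → ℝ} {α : ℕ → Λ → ℝ} {n K : ℕ} (ha : ∀ i < K, ∀ p, a i (e p) = α i p)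
    (h : MaximalRankAt a (e p₀) n) (hK : K ≤ n) :
    ∀ᶠ p in 𝓝 p₀, 𝓝 (fun i : Fin K => α i p) ≤ map (fun p (i : Fin K) => α i p) (𝓝 p) := by
  have hcomp : (fun p (i : Fin K) => α i p) = (fun q (i : Fin K) => a i q) ∘ e :=
    funext fun p => funext fun i => (ha i i.2 p).symm
  filter_upwards [he.continuous.continuousAt.eventually (h.eventually_map_nhds hK),
    he.continuous.continuousAt.eventually (eventually_eventually_nhds.2 hrange)] with p h1 h2
  have h3 : map e (𝓝 p) = 𝓝 (e p) := he.map_nhds_of_mem p h2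
  rw [hcomp, ← Filter.map_map, h3, h1]
  exact (congrArg 𝓝 (congrFun hcomp p)).le

/-! ### The first nonvanishing generalized derivative -/

section FirstIndex

variable {Λ : Type*} [TopologicalSpace Λ] {d : ℝ} {r L : ℕ∞} {ℓ : ℕ} {u : Λ → ℕ → ℝ → ℝ}
  {f : Λ → ℝ → ℝ} {α : ℕ → Λ → ℝ} {p : Λ}

theorem HasUniformDevelopment.firstGenDerivPos_iff (hdev : HasUniformDevelopment d u ℓ f α)
    {k : ℕ} (hk : k ≤ ℓ) :
    FirstGenDerivPos (u p) (f p) k ↔ (∀ i < k, α i p = 0) ∧ 0 < α k p := by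
  constructor
  · rintro ⟨h0, a, ha, hka⟩
    refine ⟨fun i hi =>
      tendsto_nhds_unique (hdev.hasGenDerivAtZero (hi.le.trans hk) p) (h0 i hi), ?_⟩
    rwa [tendsto_nhds_unique (hdev.hasGenDerivAtZero hk p) hka]
  · rintro ⟨h0, hk0⟩
    refine ⟨fun i hi => ?_, α k p, hk0, hdev.hasGenDerivAtZero hk p⟩
    rw [← h0 i hi]
    exact hdev.hasGenDerivAtZero (hi.le.trans hk) p

theorem exists_first_ne_zero {a : ℕ → ℝ} {n : ℕ} (h : ∃ i ≤ n, a i ≠ 0) :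
    ∃ j ≤ n, a j ≠ 0 ∧ ∀ i < j, a i = 0 := by
  obtain ⟨i, hi, hai⟩ := h
  have hex : ∃ i, a i ≠ 0 := ⟨i, hai⟩
  classical
  exact ⟨Nat.find hex, (Nat.find_min' hex hai).trans hi, Nat.find_spec hex,
    fun m hm => not_not.1 (Nat.find_min hex hm)⟩

/-- A monomial `u_i` beyond the first index `j` with `α_j ≠ 0` is negligible with respect to `f`. -/
theorem HasUniformDevelopment.tendsto_monomial_div (hdev : HasUniformDevelopment d u ℓ f α)
    (hscale : ∀ p, IsChebyshevScale r L d (u p)) (hd : 0 < d) (hℓ : (ℓ : ℕ∞) ≤ L) {i j : ℕ}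
    (hj : j ≤ ℓ) (h0 : ∀ i < j, α i p = 0) (hα : α j p ≠ 0) (hij : j < i) (hi : (i : ℕ∞) ≤ L) :
    Tendsto (fun x => u p i x / f p x) (𝓝[>] 0) (𝓝 0) := by
  have h1 := ((hscale p).tendsto_div_of_lt hd hij hi).mul
    ((hdev.tendsto_div hscale hd hℓ hj h0).inv₀ hα)
  rw [zero_mul] at h1
  refine h1.congr' ?_
  filter_upwards [eventually_mem_Ioo_nhdsGT_zero hd] with x hx
  have huj := (hscale p).genDeriv_pos (Nat.zero_le j) (le_trans (by exact_mod_cast hj) hℓ) x hx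
  have hne : u p j x ≠ 0 := fun h => by simp [genDeriv, h] at huj
  rw [inv_div, div_mul_div_cancel₀ hne]

theorem HasUniformDevelopment.eventually_le_mul (hdev : HasUniformDevelopment d u ℓ f α)
    (hscale : ∀ p, IsChebyshevScale r L d (u p)) (hd : 0 < d) (hℓ : (ℓ : ℕ∞) ≤ L) {j : ℕ}
    (hj : j ≤ ℓ) (h0 : ∀ i < j, α i p = 0) (hpos : ∀ x ∈ Ioo 0 d, 0 < u p j x) :
    ∀ᶠ x in 𝓝[>] (0 : ℝ), f p x ≤ (α j p + 1) * u p j x := by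
  filter_upwards [(hdev.tendsto_div hscale hd hℓ hj h0).eventually_lt_const (lt_add_one _),
    eventually_mem_Ioo_nhdsGT_zero hd] with x hx hxd
  exact ((div_lt_iff₀ (hpos x hxd)).1 hx).le

/-- `D_k f (0)` is the first nonvanishing generalized derivative if and only if `f ≃ u_k`. -/
theorem HasUniformDevelopment.firstGenDerivPos_iff_comparable
    (hdev : HasUniformDevelopment d u ℓ f α) (hscale : ∀ p, IsChebyshevScale r L d (u p))
    (hd : 0 < d) (hℓ : (ℓ : ℕ∞) ≤ L) {k : ℕ} (hk : k ≤ ℓ) :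
    FirstGenDerivPos (u p) (f p) k ↔ Comparable (f p) (u p k) := by
  rw [hdev.firstGenDerivPos_iff hk]
  constructor
  · rintro ⟨h0, hpos⟩
    have hlim := hdev.tendsto_div hscale hd hℓ hk h0
    refine ⟨α k p / 2, α k p + 1, half_pos hpos, by linarith, ?_⟩
    filter_upwards [hlim.eventually_const_lt (half_lt_self hpos),
      hlim.eventually_lt_const (lt_add_one _)] with x h1 h2 using ⟨h1.le, h2.le⟩
  · rintro ⟨A, B, hA, hB, hAB⟩
    have hkey : ∀ i < k, α i p = 0 := by
      by_contra! hcon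
      obtain ⟨i, hi, hαi⟩ := hcon
      obtain ⟨j, hj, hαj, h0⟩ := exists_first_ne_zero (a := fun i => α i p) ⟨i, le_rfl, hαi⟩
      have hlim := hdev.tendsto_monomial_div hscale hd hℓ (hj.trans (hi.le.trans hk)) h0 hαj
        (hj.trans_lt hi) (le_trans (by exact_mod_cast hk) hℓ)
      obtain ⟨x, hx1, hx2⟩ := ((hlim.eventually_lt_const (inv_pos.2 hB)).and hAB).exists
      have hpos : 0 < f p x / u p k x := hA.trans_le hx2.1
      rw [← inv_div, inv_lt_inv₀ hpos hB] at hx1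
      exact absurd hx2.2 (not_le.2 hx1)
    refine ⟨hkey, hA.trans_le ?_⟩
    exact ge_of_tendsto (hdev.tendsto_div hscale hd hℓ hk hkey) (hAB.mono fun _ h => h.1)

end FirstIndex

theorem fixMultiplicity_id_sub {Λ : Type*} [TopologicalSpace Λ] (d : ℝ)
    (f : Λ → ℝ → ℝ) (p : Λ) :
    fixMultiplicity d (fun p x => x - f p x) p = zeroMultiplicity d f p := by
  simp only [fixMultiplicity, sub_sub_cancel]

/-! ### Order of vanishing, Minkowski order and multiplicity -/

theorem mainTheorem1 {Λ : Type*} [TopologicalSpace Λ]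
    (d : ℝ) (hd : 0 < d) (r L : ℕ∞) (ℓ : ℕ) (hℓ : (ℓ : ℕ∞) ≤ L)
    (u : Λ → ℕ → ℝ → ℝ) (f : Λ → ℝ → ℝ) (α : ℕ → Λ → ℝ) (p₀ : Λ)
    -- a family with a uniform development of order `ℓ` in a family of Chebyshev scales
    (hscale : ∀ p, IsChebyshevScale r L d (u p))
    (hdev : HasUniformDevelopment d u ℓ f α)
    -- the monomials of the scale at `p₀`
    (hupos : ∀ i : ℕ, 1 ≤ i → (i : ℕ∞) ≤ L → ∀ x ∈ Ioo 0 d, 0 < u p₀ i x)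
    (humono : ∀ i : ℕ, 1 ≤ i → (i : ℕ∞) ≤ L → StrictMonoOn (u p₀ i) (Ioo 0 d))
    -- the function `f p₀`
    (hfsmooth : ContDiffOn ℝ (r : WithTop ℕ∞) (f p₀) (Ioo 0 d))
    (hfcont : ContinuousOn (f p₀) (Ico 0 d))
    (hfpos : ∀ x ∈ Ioo 0 d, 0 < f p₀ x)
    (hf0 : f p₀ 0 = 0) (hf0' : HasDerivWithinAt (f p₀) 0 (Ici 0) 0)
    (hsub : IsSublinear d (f p₀)) (hupper : UpperPowerCondition d (f p₀))
    (g : Λ → ℝ → ℝ) (hg : g = fun p x => x - f p x)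
    (x₀ : ℝ) (hx₀ : InBasin d (g p₀) x₀)
    (k : ℕ) (hk : 1 ≤ k) (hkℓ : k ≤ ℓ) :
    -- (i) amounts to `f ≃ u_k`
    (FirstGenDerivPos (u p₀) (f p₀) k ↔ Comparable (f p₀) (u p₀ k)) ∧
    -- (i) ↔ (ii)
    (FirstGenDerivPos (u p₀) (f p₀) k ↔
      Comparable (nbhdLength (orbitSet (g p₀) x₀)) (invOn d (u p₀ k))) ∧
    -- (i) → (iii)
    (FirstGenDerivPos (u p₀) (f p₀) k →
      HasCriticalMinkowskiOrder d (u p₀) ℓ (g p₀) x₀ k) ∧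
    -- (iii) → (i); finite codimension is only needed for the last index
    ((k = ℓ → ∃ i ≤ ℓ, ¬ HasGenDerivAtZero (u p₀) i (f p₀) 0) →
      HasCriticalMinkowskiOrder d (u p₀) ℓ (g p₀) x₀ k → FirstGenDerivPos (u p₀) (f p₀) k) ∧
    (FirstGenDerivPos (u p₀) (f p₀) k → fixMultiplicity d g p₀ ≤ k) ∧
    -- `Λ` as a subset of `ℝ^N`, via `e`, with `λ₀ = e p₀` in its interior
    (∀ (N : ℕ) (e : Λ → Fin N → ℝ) (a : ℕ → (Fin N → ℝ) → ℝ),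
      IsEmbedding e → range e ∈ 𝓝 (e p₀) → (∀ i ≤ ℓ, ∀ p, a i (e p) = α i p) →
        (MaximalRankAt a (e p₀) k →
          FirstGenDerivPos (u p₀) (f p₀) k → fixMultiplicity d g p₀ = k) ∧
        (MaximalRankAt a (e p₀) (k + 1) →
          (FirstGenDerivPos (u p₀) (f p₀) k ↔ fixMultiplicity d g p₀ = k))) := by

  subst hg
  simp only [fixMultiplicity_id_sub]
  have hmem : ∀ i : ℕ, i ≤ ℓ → (i : ℕ∞) ≤ L := fun i hi => le_trans (by exact_mod_cast hi) hℓ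
  have hfcont' : ContinuousOn (f p₀) (Ioo 0 d) := hfcont.mono Ioo_subset_Ico_self
  have hftend : Tendsto (f p₀) (𝓝[>] 0) (𝓝 0) := by
    have h := (hf0'.continuousWithinAt.mono Ioi_subset_Ici_self).tendsto
    rwa [hf0] at h
  have hpair : ∀ i : ℕ, 1 ≤ i → i ≤ ℓ →
      IsGaugePair d (f p₀) (u p₀ i) (nbhdLength (orbitSet (fun x => x - f p₀ x) x₀)) :=
    fun i hi1 hi => ⟨hd, hfpos, hsub, hupper, hfcont', hftend,
      ((hscale p₀).continuousOn i (hmem i hi)).mono Ioo_subset_Ico_self, humono i hi1 (hmem i hi),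
      (hscale p₀).tendsto_nhds_zero hd hi1 (hmem i hi),
      hx₀.exists_nbhdLength_bounds hfpos hf0 hf0' hsub⟩
  have hiff := fun j (hj : j ≤ ℓ) => hdev.firstGenDerivPos_iff (p := p₀) hj
  have hcomp := hdev.firstGenDerivPos_iff_comparable (p := p₀) hscale hd hℓ hkℓ
  have hzero : ∀ i j : ℕ, i ≤ ℓ → j < i → α j p₀ ≠ 0 → (∀ m < j, α m p₀ = 0) →
      upperContent d (orbitSet (fun x => x - f p₀ x) x₀) (u p₀ i) = 0 :=
    fun i j hi hji hαj h0 => (hpair i (by omega) hi).upperContent_eq_zero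
      (hdev.tendsto_monomial_div hscale hd hℓ (hji.le.trans hi) h0 hαj hji (hmem i hi))
  have hposc : ∀ i : ℕ, 1 ≤ i → i ≤ ℓ → (∀ m < i, α m p₀ = 0) →
      0 < lowerContent d (orbitSet (fun x => x - f p₀ x) x₀) (u p₀ i) :=
    fun i hi1 hi h0 => (hpair i hi1 hi).lowerContent_pos
      (hdev.eventually_le_mul hscale hd hℓ hi h0 (hupos i hi1 (hmem i hi)))
  -- the first nonvanishing coefficient is positive, because `f` is
  have hsign : ∀ j : ℕ, 1 ≤ j → j ≤ ℓ → α j p₀ ≠ 0 → (∀ m < j, α m p₀ = 0) →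
      FirstGenDerivPos (u p₀) (f p₀) j := fun j hj1 hj hαj h0 => by
    refine (hiff j hj).2 ⟨h0, lt_of_le_of_ne ?_ hαj.symm⟩
    refine ge_of_tendsto (hdev.tendsto_div hscale hd hℓ hj h0) ?_
    filter_upwards [eventually_mem_Ioo_nhdsGT_zero hd] with x hx
    exact div_nonneg (hfpos x hx).le (hupos j hj1 (hmem j hj) x hx).le
  have hle : FirstGenDerivPos (u p₀) (f p₀) k → zeroMultiplicity d f p₀ ≤ k := fun h =>
    hdev.zeroMultiplicity_le hscale hd hℓ hkℓ ((hiff k hkℓ).1 h).2.ne'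
  refine ⟨hcomp, hcomp.trans (hpair k hk hkℓ).comparable_iff, fun h => ?_, fun hfin hm => ?_, hle,
    fun N e a he hrange ha => ?_⟩
  · obtain ⟨h0, hpos⟩ := (hiff k hkℓ).1 h
    have hlow := hposc k hk hkℓ h0
    have hup := hlow.trans_le (lowerContent_le_upperContent d _ _)
    have hbound : ∀ i, i ≤ ℓ →
        0 < upperContent d (orbitSet (fun x => x - f p₀ x) x₀) (u p₀ i) → i ≤ k := by
      intro i hi hi0
      by_contra! hki
      exact hi0.ne' (hzero i k hi hki hpos.ne' h0)
    exact ⟨⟨⟨hk, hkℓ, hlow⟩, fun i hi => hbound i hi.2.1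
      (hi.2.2.trans_le (lowerContent_le_upperContent d _ _))⟩,
      ⟨⟨hk, hkℓ, hup⟩, fun i hi => hbound i hi.2.1 hi.2.2⟩⟩
  · obtain ⟨⟨-, hlowmax⟩, ⟨⟨-, -, hupk⟩, -⟩⟩ := hm
    have hex : ∃ i ≤ ℓ, α i p₀ ≠ 0 := by
      rcases eq_or_lt_of_le hkℓ with hkl | hkl
      · obtain ⟨i, hi, hne⟩ := hfin hkl
        exact ⟨i, hi, fun h0 => hne (h0 ▸ hdev.hasGenDerivAtZero hi p₀)⟩
      · -- otherwise `u_ℓ` has positive lower content, against `k < ℓ`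
        by_contra! hcon
        have := hlowmax ⟨hk.trans hkℓ, le_rfl, hposc ℓ (hk.trans hkℓ) le_rfl
          fun m hm => hcon m hm.le⟩
        omega
    obtain ⟨j, hj, hαj, h0⟩ := exists_first_ne_zero (a := fun i => α i p₀) hex
    have hkj : k ≤ j := by
      by_contra! hjk
      exact hupk.ne' (hzero k j hkℓ hjk hαj h0)
    have hjk : j ≤ k := hlowmax ⟨hk.trans hkj, hj, hposc j (hk.trans hkj) hj h0⟩
    obtain rfl : j = k := le_antisymm hjk hkj
    exact hsign j hk hj hαj h0
  · have hcg : (𝓝 p₀).IsCountablyGenerated := by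
      rw [he.nhds_eq_comap]
      infer_instance
    have hge : ∀ K n : ℕ, K ≤ n → K ≤ ℓ + 1 → MaximalRankAt a (e p₀) n → (∀ i < K, α i p₀ = 0) →
        (K : ℕ∞) ≤ zeroMultiplicity d f p₀ := fun K n hKn hKℓ hmax h0 =>
      hdev.le_zeroMultiplicity hscale hd hℓ (hk.trans hkℓ) hKℓ
        (eventually_nhds_le_map_of_isEmbedding he hrange
          (fun i hi p => ha i (by omega) p) hmax hKn) h0 (fun x hx => (hfpos x hx).ne')
    refine ⟨fun hmax h => le_antisymm (hle h) (hge k k le_rfl (by omega) hmax ((hiff k hkℓ).1 h).1),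
      fun hmax => ⟨fun h => le_antisymm (hle h)
        (hge k (k + 1) (by omega) (by omega) hmax ((hiff k hkℓ).1 h).1), fun hmult => ?_⟩⟩
    -- if `α_0, ..., α_k` all vanished, there would be perturbations with `k + 1` small zeros
    have hex : ∃ i ≤ k, α i p₀ ≠ 0 := by
      by_contra! hcon
      have h1 := hge (k + 1) (k + 1) le_rfl (by omega) hmax fun i hi => hcon i (by omega)
      rw [hmult] at h1
      have h2 : k + 1 ≤ k := by exact_mod_cast h1
      omega
    obtain ⟨j, hj, hαj, h0⟩ := exists_first_ne_zero (a := fun i => α i p₀) hex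
    have hkj := hdev.zeroMultiplicity_le hscale hd hℓ (hj.trans hkℓ) hαj
    rw [hmult] at hkj
    obtain rfl : j = k := le_antisymm hj (by exact_mod_cast hkj)
    exact hsign j hk hkℓ hαj h0
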